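/- Let $N\ge 0$ and $K\ge 1$ be integers. Let $C(S^{N-1}_{\mathbb C,K})$ (the algebra of the $K$-half-liberated complex sphere) be the universal unital $C^*$-algebra generated by $z_1,\dots,z_N$ subject to the relations $$\sum_i z_iz_i^*=1=\sum_i z_i^*z_i,\qquad [z_{i_1}\cdots z_{i_K},\,z_{j_1}\cdots z_{j_K}]=0=[z_{i_1}\cdots z_{i_K},\,z_{j_1}^*\cdots z_{j_K}^*]$$ for all indices $i_1,\dots,i_K,j_1,\dots,j_K\in\{1,\dots,N\}$. Let $S^{N-1}_{\mathbb C}=\{z\in\mathbb C^N:\sum_i|z_i|^2=1\}$, let $a_{i,c}\in C((S^{N-1}_{\mathbb C})^K)$ be the coordinate functions $a_{i,c}(x_0,\dots,x_{K-1})=(x_c)_i$, with $c$ taken modulo $K$, and let $\mathbb Z_K=\langle\tau\rangle$ act on $C((S^{N-1}_{\mathbb C})^K)$ by cyclic permutation of the factors, so that $\tau(a_{i,c})=a_{i,c+1}$. Let $C((S^{N-1}_{\mathbb C})^K)\rtimes\mathbb Z_K$ be the corresponding crossed product $C^*$-algebra, with its standard embedding $$\iota: C((S^{N-1}_{\mathbb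 C})^K)\rtimes\mathbb Z_K\hookrightarrow M_K\big(C((S^{N-1}_{\mathbb C})^K)\big),\qquad a\otimes\tau^j\mapsto\sum_{c\in\mathbb Z_K}\tau^c(a)\,E_{c,c+j}.$$ Then there is a unital $*$-homomorphism $\pi:C(S^{N-1}_{\mathbb C,K})\to C((S^{N-1}_{\mathbb C})^K)\rtimes\mathbb Z_K$ with $\pi(z_i)=a_{i,0}\otimes\tau$ for all $i$, and $\pi$ is injective. Consequently $$\iota\circ\pi:\;C(S^{N-1}_{\mathbb C,K})\to M_K\big(C((S^{N-1}_{\mathbb C})^K)\big)$$ is injective, i.e. it is a faithful matrix model for the $K$-half-liberated complex sphere. -/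

import Mathlib

open scoped ComplexConjugate

noncomputable section

/-! ## The free `*`-algebra on `N` generators -/

/-- The algebra `ℂ⟨z₁, …, z_N, z₁*, …, z_N*⟩` of noncommutative `*`-polynomials: the letter
`Sum.inl i` stands for `zᵢ` and `Sum.inr i` for `zᵢ*`. -/
def FreeStarAlg (N : ℕ) : Type := FreeAlgebra ℂ (Fin N ⊕ Fin N)

namespace FreeStarAlg

variable {N : ℕ}

instance : Ring (FreeStarAlg N) := inferInstanceAs (Ring (FreeAlgebra ℂ (Fin N ⊕ Fin N)))

instance : Algebra ℂ (FreeStarAlg N) :=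
  inferInstanceAs (Algebra ℂ (FreeAlgebra ℂ (Fin N ⊕ Fin N)))

/-- The letters. -/
def letter (x : Fin N ⊕ Fin N) : FreeStarAlg N := FreeAlgebra.ι ℂ x

/-- The algebra map determined by the images of the letters. -/
def liftLetters {B : Type*} [Semiring B] [Algebra ℂ B] (f : Fin N ⊕ Fin N → B) :
    FreeStarAlg N →ₐ[ℂ] B :=
  FreeAlgebra.lift ℂ f

theorem liftLetters_letter {B : Type*} [Semiring B] [Algebra ℂ B] (f : Fin N ⊕ Fin N → B)
    (x : Fin N ⊕ Fin N) : liftLetters f (letter x) = f x :=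
  FreeAlgebra.lift_ι_apply f x

theorem induction {C : FreeStarAlg N → Prop}
    (hs : ∀ c : ℂ, C (algebraMap ℂ (FreeStarAlg N) c)) (hl : ∀ x, C (letter x))
    (hm : ∀ a b, C a → C b → C (a * b)) (ha : ∀ a b, C a → C b → C (a + b))
    (p : FreeStarAlg N) : C p :=
  FreeAlgebra.induction ℂ (Fin N ⊕ Fin N) (motive := C) hs hl hm ha p

/-- The opposite of the free `*`-algebra with scalars acting through complex conjugation (an
auxiliary algebra, used only to build the involution). -/
def ConjOp (N : ℕ) : Type := (FreeStarAlg N)ᵐᵒᵖ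

instance : Ring (ConjOp N) := inferInstanceAs (Ring (FreeStarAlg N)ᵐᵒᵖ)

instance : Algebra ℂ (ConjOp N) :=
  RingHom.toAlgebra' ((algebraMap ℂ (FreeStarAlg N)ᵐᵒᵖ).comp (starRingEnd ℂ))
    (fun c x => Algebra.commutes (A := (FreeStarAlg N)ᵐᵒᵖ) (conj c) x)

/-- The involution as a ring map into the opposite ring: it is conjugate-linear, reverses products
and exchanges `zᵢ` and `zᵢ*`. -/
def starHom (N : ℕ) : FreeStarAlg N →+* (FreeStarAlg N)ᵐᵒᵖ :=
  (liftLetters (B := ConjOp N) (fun x => MulOpposite.op (letter x.swap))).toRingHom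

theorem starHom_letter (x : Fin N ⊕ Fin N) :
    starHom N (letter x) = MulOpposite.op (letter x.swap) :=
  liftLetters_letter (B := ConjOp N) _ x

theorem starHom_algebraMap (c : ℂ) :
    starHom N (algebraMap ℂ _ c) = MulOpposite.op (algebraMap ℂ _ (conj c)) :=
  (liftLetters (B := ConjOp N) (fun x => MulOpposite.op (letter x.swap))).commutes c

instance : StarRing (FreeStarAlg N) where
  star p := (starHom N p).unop
  star_involutive p := by
    induction p using FreeStarAlg.induction with
    | hs c => simp [starHom_algebraMap]
    | hl x => simp [starHom_letter]
    | hm a b ha hb => simp [ha, hb]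
    | ha a b ha hb => simp [ha, hb]
  star_mul a b := by simp
  star_add a b := by simp

theorem star_def (p : FreeStarAlg N) : star p = (starHom N p).unop := rfl

theorem star_letter (x : Fin N ⊕ Fin N) : star (letter x) = letter x.swap := by
  simp [star_def, starHom_letter]

theorem star_algebraMap (c : ℂ) :
    star (algebraMap ℂ (FreeStarAlg N) c) = algebraMap ℂ _ (conj c) := by
  simp [star_def, starHom_algebraMap]

instance : StarModule ℂ (FreeStarAlg N) where
  star_smul c p := by
    rw [Algebra.smul_def, star_mul, star_algebraMap, Algebra.smul_def, Algebra.commutes]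
    rfl

/-- Evaluation of a `*`-polynomial at a tuple of elements of a `*`-algebra. -/
def eval {B : Type*} [Ring B] [StarRing B] [Algebra ℂ B] [StarModule ℂ B] (z : Fin N → B) :
    FreeStarAlg N →⋆ₐ[ℂ] B where
  __ := liftLetters (Sum.elim z (fun i => star (z i)))
  map_star' p := by
    change liftLetters _ _ = star (liftLetters _ _)
    induction p using FreeStarAlg.induction with
    | hs c => rw [star_algebraMap, AlgHom.commutes, AlgHom.commutes]; exact algebraMap_star_comm c
    | hl x => cases x <;> simp [star_letter, liftLetters_letter]
    | hm a b ha hb => simp [ha, hb]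
    | ha a b ha hb => simp [ha, hb]

theorem eval_letter {B : Type*} [Ring B] [StarRing B] [Algebra ℂ B] [StarModule ℂ B]
    (z : Fin N → B) (x : Fin N ⊕ Fin N) :
    eval z (letter x) = Sum.elim z (fun i => star (z i)) x :=
  liftLetters_letter _ x

end FreeStarAlg

/-! ## The `K`-half-liberated complex sphere -/

/-- The relations defining the `K`-half-liberated sphere: `∑ zᵢ zᵢ* = 1 = ∑ zᵢ* zᵢ` (the free
sphere) and `[z_{i₁} ⋯ z_{i_K}, z_{j₁} ⋯ z_{j_K}] = 0 = [z_{i₁} ⋯ z_{i_K}, z_{j₁}* ⋯ z_{j_K}*]`. -/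
structure IsHalfLiberated {N : ℕ} (K : ℕ) {B : Type*} [Ring B] [StarRing B] (z : Fin N → B) :
    Prop where
  sum_mul_star : ∑ i, z i * star (z i) = 1
  sum_star_mul : ∑ i, star (z i) * z i = 1
  commute : ∀ i j : Fin K → Fin N,
    Commute (List.ofFn fun k => z (i k)).prod (List.ofFn fun k => z (j k)).prod
  commute_star : ∀ i j : Fin K → Fin N,
    Commute (List.ofFn fun k => z (i k)).prod (List.ofFn fun k => star (z (j k))).prod

theorem IsHalfLiberated.norm_le_one {N K : ℕ} {B : Type*} [CStarAlgebra B] {z : Fin N → B}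
    (hz : IsHalfLiberated K z) (i : Fin N) : ‖z i‖ ≤ 1 := by
  let _ := CStarAlgebra.spectralOrder B
  have := CStarAlgebra.spectralOrderedRing B
  have h : star (z i) * z i ≤ 1 := by
    rw [← hz.sum_star_mul]
    exact Finset.single_le_sum (f := fun i => star (z i) * z i)
      (fun j _ => star_mul_self_nonneg (z j)) (Finset.mem_univ i)
  have h2 : ‖star (z i) * z i‖ ≤ 1 :=
    (CStarAlgebra.norm_le_one_iff_of_nonneg _ (star_mul_self_nonneg (z i))).2 h
  rw [CStarRing.norm_star_mul_self] at h2
  nlinarith [norm_nonneg (z i)]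

/-- The algebra of `*`-polynomials in `N` variables, to be normed by the largest `C*`-seminorm
compatible with the relations of the `K`-half-liberated sphere. -/
def HLPoly (N K : ℕ) : Type := FreeStarAlg N

namespace HLPoly

variable {N K : ℕ}

instance : Ring (HLPoly N K) := inferInstanceAs (Ring (FreeStarAlg N))
instance : Algebra ℂ (HLPoly N K) := inferInstanceAs (Algebra ℂ (FreeStarAlg N))
instance : StarRing (HLPoly N K) := inferInstanceAs (StarRing (FreeStarAlg N))
instance : StarModule ℂ (HLPoly N K) := inferInstanceAs (StarModule ℂ (FreeStarAlg N))

/-- Evaluation of a `*`-polynomial at a tuple. -/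
def eval {B : Type*} [Ring B] [StarRing B] [Algebra ℂ B] [StarModule ℂ B] (z : Fin N → B) :
    HLPoly N K →⋆ₐ[ℂ] B :=
  FreeStarAlg.eval z

/-- The values `‖p(z)‖`, for `z` an `N`-tuple in a `C*`-algebra satisfying the relations. (A
`C*`-algebra generated by `N` elements has at most the cardinality of the continuum, so algebras
in `Type` suffice.) -/
def normValues (p : HLPoly N K) : Set ℝ :=
  {r | ∃ (B : Type) (_ : CStarAlgebra B) (z : Fin N → B), IsHalfLiberated K z ∧ r = ‖eval z p‖}

/-- The universal `C*`-seminorm: the supremum of `‖p(z)‖` over all `z` as above. -/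
instance : Norm (HLPoly N K) where
  norm p := sSup (normValues p)

theorem norm_def (p : HLPoly N K) : ‖p‖ = sSup (normValues p) := rfl

theorem norm_one_le (B : Type*) [CStarAlgebra B] : ‖(1 : B)‖ ≤ 1 := by
  have h := CStarRing.norm_star_mul_self (x := (1 : B))
  rw [star_one, mul_one] at h
  nlinarith [norm_nonneg (1 : B), sq_nonneg (‖(1 : B)‖ - 1)]

/-- The supremum defining the universal seminorm is finite. -/
theorem bddAbove_normValues (p : HLPoly N K) : BddAbove (normValues p) := by
  suffices h : ∃ C : ℝ, 0 ≤ C ∧ ∀ (B : Type) (_ : CStarAlgebra B) (z : Fin N → B),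
      IsHalfLiberated K z → ‖eval z p‖ ≤ C by
    obtain ⟨C, -, hC⟩ := h
    refine ⟨C, ?_⟩
    rintro r ⟨B, _, z, hz, rfl⟩
    exact hC B _ z hz
  induction p using FreeStarAlg.induction with
  | hs c =>
    refine ⟨‖c‖, norm_nonneg c, fun B _ z _ => ?_⟩
    have h : eval z (algebraMap ℂ (HLPoly N K) c) = c • (1 : B) := by
      rw [AlgHomClass.commutes, Algebra.algebraMap_eq_smul_one]
    refine (congrArg norm h).trans_le ?_
    rw [norm_smul]
    exact mul_le_of_le_one_right (norm_nonneg c) (norm_one_le B)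
  | hl x =>
    refine ⟨1, zero_le_one, fun B _ z hz => ?_⟩
    refine (congrArg norm (FreeStarAlg.eval_letter z x)).trans_le ?_
    cases x with
    | inl i => exact hz.norm_le_one i
    | inr i => simpa using hz.norm_le_one i
  | hm a b ha hb =>
    obtain ⟨C, hC0, hC⟩ := ha
    obtain ⟨D, hD0, hD⟩ := hb
    refine ⟨C * D, mul_nonneg hC0 hD0, fun B _ z hz => ?_⟩
    refine (congrArg norm (map_mul (eval (K := K) z) a b)).trans_le ?_
    exact (norm_mul_le _ _).trans
      (mul_le_mul (hC B _ z hz) (hD B _ z hz) (norm_nonneg _) hC0)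
  | ha a b ha hb =>
    obtain ⟨C, hC0, hC⟩ := ha
    obtain ⟨D, hD0, hD⟩ := hb
    refine ⟨C + D, add_nonneg hC0 hD0, fun B _ z hz => ?_⟩
    refine (congrArg norm (map_add (eval (K := K) z) a b)).trans_le ?_
    exact (norm_add_le _ _).trans (add_le_add (hC B _ z hz) (hD B _ z hz))

theorem norm_eval_le (p : HLPoly N K) {B : Type} [CStarAlgebra B] {z : Fin N → B}
    (hz : IsHalfLiberated K z) : ‖eval z p‖ ≤ ‖p‖ :=
  le_csSup (bddAbove_normValues p) ⟨B, _, z, hz, rfl⟩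

theorem norm_le_of {p : HLPoly N K} {C : ℝ} (hC : 0 ≤ C)
    (h : ∀ (B : Type) [CStarAlgebra B] (z : Fin N → B), IsHalfLiberated K z → ‖eval z p‖ ≤ C) :
    ‖p‖ ≤ C := by
  refine Real.sSup_le ?_ hC
  rintro r ⟨B, _, z, hz, rfl⟩
  exact h B z hz

theorem norm_nonneg' (p : HLPoly N K) : 0 ≤ ‖p‖ := by
  refine Real.sSup_nonneg ?_
  rintro r ⟨B, _, z, hz, rfl⟩
  exact norm_nonneg _

/-- The universal seminorm as a ring seminorm. -/
def ringSeminorm (N K : ℕ) : RingSeminorm (HLPoly N K) where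
  toFun p := ‖p‖
  map_zero' := le_antisymm (norm_le_of le_rfl fun B _ z _ => by simp) (norm_nonneg' _)
  add_le' p q := norm_le_of (add_nonneg (norm_nonneg' p) (norm_nonneg' q)) fun B _ z hz => by
    rw [map_add]
    exact (norm_add_le _ _).trans (add_le_add (norm_eval_le p hz) (norm_eval_le q hz))
  neg' p := by
    simp only [norm_def, normValues, map_neg, norm_neg]
  mul_le' p q := norm_le_of (mul_nonneg (norm_nonneg' p) (norm_nonneg' q)) fun B _ z hz => by
    rw [map_mul]
    exact (norm_mul_le _ _).trans
      (mul_le_mul (norm_eval_le p hz) (norm_eval_le q hz) (norm_nonneg _) (norm_nonneg' p))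

instance : SeminormedRing (HLPoly N K) := (ringSeminorm N K).toSeminormedRing

instance : NormedAlgebra ℂ (HLPoly N K) where
  norm_smul_le c p := norm_le_of (mul_nonneg (norm_nonneg c) (norm_nonneg' p))
    fun B _ z hz => by
      rw [map_smul, norm_smul]
      exact mul_le_mul_of_nonneg_left (norm_eval_le p hz) (norm_nonneg c)

instance : NormedStarGroup (HLPoly N K) where
  norm_star_le p := norm_le_of (norm_nonneg' p) fun B _ z hz => by
    rw [map_star, norm_star]
    exact norm_eval_le p hz

theorem norm_mul_self_le (p : HLPoly N K) : ‖p‖ * ‖p‖ ≤ ‖star p * p‖ := by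
  have h : ‖p‖ ≤ √‖star p * p‖ := norm_le_of (Real.sqrt_nonneg _) fun B _ z hz => by
    refine Real.le_sqrt_of_sq_le ?_
    rw [sq, ← CStarRing.norm_star_mul_self, ← map_star, ← map_mul]
    exact norm_eval_le _ hz
  calc ‖p‖ * ‖p‖ ≤ √‖star p * p‖ * √‖star p * p‖ :=
        mul_le_mul h h (norm_nonneg _) (Real.sqrt_nonneg _)
    _ = _ := Real.mul_self_sqrt (norm_nonneg _)

end HLPoly

/-- `C(S^{N-1}_{ℂ,K})`, the algebra of the `K`-half-liberated complex sphere: the universal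
`C*`-algebra generated by `z₁, …, z_N` subject to `IsHalfLiberated`, constructed as the separated
completion of the `*`-polynomials for the universal `C*`-seminorm. -/
def HLSphere (N K : ℕ) : Type := UniformSpace.Completion (HLPoly N K)

namespace HLSphere

open UniformSpace

variable {N K : ℕ}

instance : NormedRing (HLSphere N K) :=
  inferInstanceAs (NormedRing (Completion (HLPoly N K)))

instance : CompleteSpace (HLSphere N K) :=
  inferInstanceAs (CompleteSpace (Completion (HLPoly N K)))

instance : Algebra ℂ (HLSphere N K) :=
  inferInstanceAs (Algebra ℂ (Completion (HLPoly N K)))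

/-- The class of a `*`-polynomial. -/
def ofPoly (p : HLPoly N K) : HLSphere N K := (p : Completion (HLPoly N K))

theorem denseRange_ofPoly : DenseRange (ofPoly : HLPoly N K → HLSphere N K) :=
  Completion.denseRange_coe

theorem norm_ofPoly (p : HLPoly N K) : ‖ofPoly p‖ = ‖p‖ := Completion.norm_coe p

theorem continuous_ofPoly : Continuous (ofPoly : HLPoly N K → HLSphere N K) :=
  Completion.continuous_coe _

theorem ofPoly_mul (p q : HLPoly N K) : ofPoly (p * q) = ofPoly p * ofPoly q :=
  Completion.coe_mul p q

theorem ofPoly_add (p q : HLPoly N K) : ofPoly (p + q) = ofPoly p + ofPoly q :=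
  Completion.coe_add p q

theorem ofPoly_smul (c : ℂ) (p : HLPoly N K) : ofPoly (c • p) = c • ofPoly p :=
  Completion.coe_smul c p

instance : NormedAlgebra ℂ (HLSphere N K) where
  norm_smul_le c x :=
    norm_smul_le (β := Completion (HLPoly N K)) c x

instance : Star (HLSphere N K) where
  star := Completion.map (star : HLPoly N K → HLPoly N K)

theorem continuous_star' : Continuous (star : HLSphere N K → HLSphere N K) :=
  Completion.continuous_map

theorem star_ofPoly (p : HLPoly N K) : star (ofPoly p) = ofPoly (star p) :=
  Completion.map_coe star_isometry.uniformContinuous p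

instance : StarRing (HLSphere N K) where
  star_involutive x := by
    refine denseRange_ofPoly.induction_on
      (p := fun x : HLSphere N K => star (star x) = x) x
      (isClosed_eq (continuous_star'.comp continuous_star') continuous_id) fun p => ?_
    rw [star_ofPoly, star_ofPoly, star_star]
  star_mul x y := by
    refine denseRange_ofPoly.induction_on₂
      (p := fun x y : HLSphere N K => star (x * y) = star y * star x) ?_ (fun p q => ?_) x y
    · exact isClosed_eq (continuous_star'.comp continuous_mul)
        ((continuous_star'.comp continuous_snd).mul (continuous_star'.comp continuous_fst))
    · rw [← ofPoly_mul, star_ofPoly, star_mul, ofPoly_mul, star_ofPoly, star_ofPoly]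
  star_add x y := by
    refine denseRange_ofPoly.induction_on₂
      (p := fun x y : HLSphere N K => star (x + y) = star x + star y) ?_ (fun p q => ?_) x y
    · exact isClosed_eq (continuous_star'.comp continuous_add)
        ((continuous_star'.comp continuous_fst).add (continuous_star'.comp continuous_snd))
    · rw [← ofPoly_add, star_ofPoly, star_add, ofPoly_add, star_ofPoly, star_ofPoly]

instance : StarModule ℂ (HLSphere N K) where
  star_smul c x := by
    refine denseRange_ofPoly.induction_on
      (p := fun x : HLSphere N K => star (c • x) = star c • star x) x
      (isClosed_eq (continuous_star'.comp (continuous_const_smul c))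
        ((continuous_const_smul (star c)).comp continuous_star')) fun p => ?_
    rw [← ofPoly_smul, star_ofPoly, star_smul, ofPoly_smul, star_ofPoly]

instance : CStarRing (HLSphere N K) where
  norm_mul_self_le x := by
    refine denseRange_ofPoly.induction_on
      (p := fun x : HLSphere N K => ‖x‖ * ‖x‖ ≤ ‖star x * x‖) x
      (isClosed_le (continuous_norm.mul continuous_norm)
        (continuous_norm.comp (continuous_star'.mul continuous_id))) fun p => ?_
    rw [star_ofPoly, ← ofPoly_mul, norm_ofPoly, norm_ofPoly]
    exact HLPoly.norm_mul_self_le p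

instance : CStarAlgebra (HLSphere N K) where

/-- The standard coordinates `zᵢ`. -/
def z (i : Fin N) : HLSphere N K := ofPoly (FreeStarAlg.letter (Sum.inl i) : FreeStarAlg N)

end HLSphere

/-! ## Crossed products by finite groups -/

/-- The crossed product `A ⋊ G` of a `C*`-algebra by an action `α` of a finite group (written
additively): elements are formal sums `∑ g, x g ⊗ g` with `x g ∈ A`, multiplied by
`(a ⊗ g) (b ⊗ h) = a α_g(b) ⊗ (g + h)`, with involution `(a ⊗ g)* = α_{-g}(a*) ⊗ (-g)`. As `G` is
finite no completion is needed. -/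
@[ext]
structure CrossedProduct {G A : Type*} [AddGroup G] [CStarAlgebra A]
    (α : Multiplicative G →* (A ≃⋆ₐ[ℂ] A)) where
  /-- The coefficient at a group element. -/
  coeff : G → A

namespace CrossedProduct

section Embedding

variable {G A : Type*} [AddGroup G] [CStarAlgebra A] {α : Multiplicative G →* (A ≃⋆ₐ[ℂ] A)}

/-- The automorphism by which `g : G` acts. -/
def act (α : Multiplicative G →* (A ≃⋆ₐ[ℂ] A)) (g : G) : A ≃⋆ₐ[ℂ] A :=
  α (Multiplicative.ofAdd g)

theorem act_zero (a : A) : act α 0 a = a := by simp [act]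

theorem act_act (g h : G) (a : A) : act α g (act α h a) = act α (g + h) a := by
  simp [act, ofAdd_add]

/-- The elementary element `a ⊗ g`. -/
def tmul [DecidableEq G] (a : A) (g : G) : CrossedProduct α := ⟨Pi.single g a⟩

instance : Zero (CrossedProduct α) := ⟨⟨0⟩⟩
instance [DecidableEq G] : One (CrossedProduct α) := ⟨tmul 1 0⟩
instance : Add (CrossedProduct α) := ⟨fun x y => ⟨x.coeff + y.coeff⟩⟩
instance : Neg (CrossedProduct α) := ⟨fun x => ⟨-x.coeff⟩⟩
instance : SMul ℂ (CrossedProduct α) := ⟨fun r x => ⟨r • x.coeff⟩⟩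
instance [Fintype G] : Mul (CrossedProduct α) :=
  ⟨fun x y => ⟨fun h => ∑ g, x.coeff g * act α g (y.coeff (-g + h))⟩⟩
instance : Star (CrossedProduct α) := ⟨fun x => ⟨fun g => act α g (star (x.coeff (-g)))⟩⟩

/-- The underlying map of the standard embedding `A ⋊ G ⊆ M_G(A)`, which sends `a ⊗ g` to
`∑ c, α_c(a) E_{c, c + g}`. -/
def toMatrixFun (x : CrossedProduct α) : CStarMatrix G G A :=
  CStarMatrix.ofMatrix fun c d => act α c (x.coeff (-c + d))

theorem toMatrixFun_apply (x : CrossedProduct α) (c d : G) :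
    toMatrixFun x c d = act α c (x.coeff (-c + d)) := rfl

theorem toMatrixFun_injective :
    Function.Injective (toMatrixFun : CrossedProduct α → CStarMatrix G G A) := by
  intro x y h
  ext g
  have h0 : toMatrixFun x 0 g = toMatrixFun y 0 g := by rw [h]
  simpa [toMatrixFun_apply, act_zero] using h0

theorem toMatrixFun_zero : toMatrixFun (0 : CrossedProduct α) = 0 := by
  ext c d
  exact map_zero (act α c)

theorem toMatrixFun_add (x y : CrossedProduct α) :
    toMatrixFun (x + y) = toMatrixFun x + toMatrixFun y := by
  ext c d
  exact map_add (act α c) _ _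

theorem toMatrixFun_neg (x : CrossedProduct α) : toMatrixFun (-x) = -toMatrixFun x := by
  ext c d
  exact map_neg (act α c) _

theorem toMatrixFun_smul (r : ℂ) (x : CrossedProduct α) :
    toMatrixFun (r • x) = r • toMatrixFun x := by
  ext c d
  exact map_smul (act α c) _ _

theorem toMatrixFun_star (x : CrossedProduct α) : toMatrixFun (star x) = star (toMatrixFun x) := by
  ext c d
  change act α c (act α (-c + d) (star (x.coeff (-(-c + d))))) = star (act α d (x.coeff (-d + c)))
  rw [act_act, ← map_star]
  simp

theorem toMatrixFun_one [DecidableEq G] : toMatrixFun (1 : CrossedProduct α) = 1 := by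
  ext c d
  change act α c (Pi.single (M := fun _ : G => A) 0 1 (-c + d)) = (1 : Matrix G G A) c d
  by_cases h : c = d
  · subst h
    simp
  · have h' : -c + d ≠ 0 := fun e => h (neg_add_eq_zero.1 e)
    simp [h, h']

theorem toMatrixFun_mul [Fintype G] (x y : CrossedProduct α) :
    toMatrixFun (x * y) = toMatrixFun x * toMatrixFun y := by
  ext c d
  change act α c (∑ g, x.coeff g * act α g (y.coeff (-g + (-c + d)))) =
    ∑ e, act α c (x.coeff (-c + e)) * act α e (y.coeff (-e + d))
  rw [map_sum]
  refine Fintype.sum_equiv (Equiv.addLeft c) _ _ fun g => ?_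
  rw [map_mul, act_act]
  simp [add_assoc]

end Embedding

section Algebra

variable {G A : Type*} [AddGroup G] [Fintype G] [DecidableEq G] [CStarAlgebra A]
  {α : Multiplicative G →* (A ≃⋆ₐ[ℂ] A)}

instance : Ring (CrossedProduct α) :=
  Ring.ofMinimalAxioms
    (fun x y z => toMatrixFun_injective <| by simp only [toMatrixFun_add, add_assoc])
    (fun x => toMatrixFun_injective <| by simp only [toMatrixFun_add, toMatrixFun_zero, zero_add])
    (fun x => toMatrixFun_injective <| by
      simp only [toMatrixFun_add, toMatrixFun_neg, toMatrixFun_zero, neg_add_cancel])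
    (fun x y z => toMatrixFun_injective <| by simp only [toMatrixFun_mul, mul_assoc])
    (fun x => toMatrixFun_injective <| by simp only [toMatrixFun_mul, toMatrixFun_one, one_mul])
    (fun x => toMatrixFun_injective <| by simp only [toMatrixFun_mul, toMatrixFun_one, mul_one])
    (fun x y z => toMatrixFun_injective <| by
      simp only [toMatrixFun_mul, toMatrixFun_add, mul_add])
    (fun x y z => toMatrixFun_injective <| by
      simp only [toMatrixFun_mul, toMatrixFun_add, add_mul])

/-- The embedding as an additive map. -/
def toMatrixAddHom : CrossedProduct α →+ CStarMatrix G G A where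
  toFun := toMatrixFun
  map_zero' := toMatrixFun_zero
  map_add' := toMatrixFun_add

instance : Module ℂ (CrossedProduct α) :=
  Function.Injective.module ℂ (toMatrixAddHom (α := α)) toMatrixFun_injective toMatrixFun_smul

instance : Algebra ℂ (CrossedProduct α) :=
  Algebra.ofModule
    (fun r x y => toMatrixFun_injective <| by
      simp only [toMatrixFun_mul, toMatrixFun_smul, smul_mul_assoc])
    (fun r x y => toMatrixFun_injective <| by
      simp only [toMatrixFun_mul, toMatrixFun_smul, mul_smul_comm])

instance : StarRing (CrossedProduct α) where
  star_involutive x := toMatrixFun_injective <| by simp only [toMatrixFun_star, star_star]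
  star_mul x y := toMatrixFun_injective <| by
    simp only [toMatrixFun_star, toMatrixFun_mul, star_mul]
  star_add x y := toMatrixFun_injective <| by
    simp only [toMatrixFun_star, toMatrixFun_add, star_add]

instance : StarModule ℂ (CrossedProduct α) where
  star_smul r x := toMatrixFun_injective <| by
    simp only [toMatrixFun_star, toMatrixFun_smul, star_smul]

/-- The standard embedding `A ⋊ G ⊆ M_G(A)`, `a ⊗ g ↦ ∑ c, α_c(a) E_{c, c + g}`. -/
def toMatrix (α : Multiplicative G →* (A ≃⋆ₐ[ℂ] A)) :
    CrossedProduct α →⋆ₐ[ℂ] CStarMatrix G G A where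
  toFun := toMatrixFun
  map_one' := toMatrixFun_one
  map_mul' := toMatrixFun_mul
  map_zero' := toMatrixFun_zero
  map_add' := toMatrixFun_add
  commutes' r := by
    rw [Algebra.algebraMap_eq_smul_one, Algebra.algebraMap_eq_smul_one, toMatrixFun_smul,
      toMatrixFun_one]
  map_star' := toMatrixFun_star

/-- The `C*`-norm of the crossed product, induced by the standard embedding into the
`C*`-algebra `M_G(A)`. -/
instance : NormedRing (CrossedProduct α) :=
  letI := CStarAlgebra.spectralOrder A
  haveI := CStarAlgebra.spectralOrderedRing A
  NormedRing.induced (CrossedProduct α) (CStarMatrix G G A) (toMatrix α) toMatrixFun_injective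

theorem isometry_toMatrix :
    letI := CStarAlgebra.spectralOrder A
    haveI := CStarAlgebra.spectralOrderedRing A
    Isometry (toMatrix α) := by
  letI := CStarAlgebra.spectralOrder A
  haveI := CStarAlgebra.spectralOrderedRing A
  exact AddMonoidHomClass.isometry_of_norm (toMatrix α) fun _ => rfl

instance : NormedAlgebra ℂ (CrossedProduct α) where
  norm_smul_le r x := by
    letI := CStarAlgebra.spectralOrder A
    haveI := CStarAlgebra.spectralOrderedRing A
    change ‖toMatrix α (r • x)‖ ≤ ‖r‖ * ‖toMatrix α x‖
    rw [map_smul]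
    exact norm_smul_le r _

instance : CStarRing (CrossedProduct α) where
  norm_mul_self_le x := by
    letI := CStarAlgebra.spectralOrder A
    haveI := CStarAlgebra.spectralOrderedRing A
    change ‖toMatrix α x‖ * ‖toMatrix α x‖ ≤ ‖toMatrix α (star x * x)‖
    rw [map_mul, map_star]
    exact CStarRing.norm_mul_self_le _

instance : CompleteSpace (CrossedProduct α) := by
  letI := CStarAlgebra.spectralOrder A
  haveI := CStarAlgebra.spectralOrderedRing A
  have hr : Set.range (toMatrix α) =
      {M : CStarMatrix G G A | ∀ c d, M c d = act α c (M 0 (-c + d))} := by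
    ext M
    constructor
    · rintro ⟨x, rfl⟩ c d
      change act α c (x.coeff (-c + d)) = act α c (act α 0 (x.coeff (-0 + (-c + d))))
      simp [act_zero]
    · intro hM
      refine ⟨⟨fun g => M 0 g⟩, ?_⟩
      ext c d
      exact (hM c d).symm
  have hev : ∀ c d : G, Continuous fun M : CStarMatrix G G A => M c d := fun c d =>
    (continuous_apply d).comp (continuous_apply (A := fun _ : G => G → A) c)
  have hact : ∀ c : G, Continuous (act α c) := fun c =>
    (StarAlgEquiv.isometry (act α c)).continuous
  refine (completeSpace_iff_isComplete_range (isometry_toMatrix (α := α)).isUniformInducing).2 ?_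
  refine IsClosed.isComplete ?_
  rw [hr]
  simp only [Set.ofPred_forall]
  exact isClosed_iInter fun c => isClosed_iInter fun d =>
    isClosed_eq (hev c d) ((hact c).comp (hev 0 _))

instance : CStarAlgebra (CrossedProduct α) where

end Algebra

end CrossedProduct

/-! ## Powers of the complex sphere and the cyclic action -/

/-- The standard complex sphere `S^{N-1}_ℂ = {z ∈ ℂᴺ : ∑ |zᵢ|² = 1}`. -/
abbrev ComplexSphere (N : ℕ) : Type := Metric.sphere (0 : EuclideanSpace ℂ (Fin N)) 1

/-- The product `(S^{N-1}_ℂ)^K` of `K` copies of the complex sphere, the factors being indexed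
modulo `K`. -/
abbrev SpherePower (N K : ℕ) : Type := ZMod K → ComplexSphere N

/-- The coordinate functions `a_{i,c}(z₀, …, z_{K-1}) = (z_c)ᵢ`. -/
def coordFun {N K : ℕ} (i : Fin N) (c : ZMod K) : C(SpherePower N K, ℂ) where
  toFun x := (x c : EuclideanSpace ℂ (Fin N)) i
  continuous_toFun := by fun_prop

/-- The homeomorphism `τᵍ` of `(S^{N-1}_ℂ)^K`, where `τ` is the cyclic permutation
`τ(z₀, …, z_{K-1}) = (z_{K-1}, z₀, …, z_{K-2})`. -/
def cyclicShift (N K : ℕ) (g : ZMod K) : SpherePower N K ≃ₜ SpherePower N K where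
  toFun x c := x (c - g)
  invFun x c := x (c + g)
  left_inv x := by simp
  right_inv x := by simp
  continuous_toFun := by fun_prop
  continuous_invFun := by fun_prop

/-- The action of `ℤ_K` on `C((S^{N-1}_ℂ)^K)` induced by the cyclic permutation of the factors:
`g` acts by `f ↦ f ∘ τ⁻ᵍ`. -/
def cyclicAction (N K : ℕ) [NeZero K] :
    Multiplicative (ZMod K) →*
      (C(SpherePower N K, ℂ) ≃⋆ₐ[ℂ] C(SpherePower N K, ℂ)) where
  toFun g := (cyclicShift N K g.toAdd).symm.compStarAlgEquiv' ℂ ℂ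
  map_one' := by
    ext f x
    change f (fun c => x (c + 0)) = f x
    simp
  map_mul' g h := by
    ext f x
    change f (fun c => x (c + (g.toAdd + h.toAdd))) = f (fun c => x (c + h.toAdd + g.toAdd))
    congr 1
    funext c
    congr 1
    ring

end

open scoped ComplexConjugate

noncomputable section

/-! Existence of `π` is a degree count: a word of length `K` in the elements `a_{i,0} ⊗ τ` has
degree `K = 0` in `ℤ_K`, so it lies in the commutative coefficient algebra.

Injectivity is reduced to degree zero. The words of length `K` generate a commutative `*`-algebra;
let `D` be its closure. Averaging over the gauge automorphisms `zᵢ ↦ ζᵏ zᵢ`, with `ζ` a primitive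
`K`-th root of unity, gives a faithful map `E` with values in `D` (`expectation_mem`,
`eq_zero_of_expectation_star_mul_self`), and `π (E x)` and `π x` have the same coefficient at `0`
(`coeff_model_expectation`). If `π x = 0`, the coefficient of `π (E (x* x))` at `0` vanishes, and it
remains to deduce `E (x* x) = 0`.

Since `D` is commutative, Gelfand theory asks only that every continuous character `χ` of `D` be the
coefficient at `0` of `π` evaluated at a point of the sphere power. Put `T(I) = χ(z_{i₁} ⋯
z_{i_K})`, a tensor of norm one. The relations imply `zᵢ w zⱼ = zⱼ w zᵢ` for words `w` of length `K
- 1` (`mul_word_mul_comm`), so `T(I) T(J)` is unchanged when the `c`-th indices of `I` and `J` are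
exchanged. These are the Segre equations: `T` has rank one and factors into `K` unit vectors
(`exists_sphere_prod_eq`), which form the required point.

The recurring algebraic device is to insert `1 = ∑ zₖ* zₖ`, or its analogue for longer words. It
puts `zᵢ zⱼ*` and `zᵢ* zⱼ` into the block algebra and moves adjoint letters into block coefficients,
so every `*`-polynomial is a sum of terms `a w` with `a` in the block algebra and `w` a word without
adjoints. On such terms `E` is explicit. -/

/-! ## Words in the generators of a half-liberated sphere -/

section Words

variable {N K : ℕ} {B : Type*} [Ring B]

/-- The product `z_{l₁} ⋯ z_{lₙ}` along a list of indices. -/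
def word (z : Fin N → B) (l : List (Fin N)) : B := (l.map z).prod

theorem word_nil (z : Fin N → B) : word z [] = 1 := rfl

theorem word_cons (z : Fin N → B) (i : Fin N) (l : List (Fin N)) :
    word z (i :: l) = z i * word z l := by simp [word]

theorem word_append (z : Fin N → B) (l m : List (Fin N)) :
    word z (l ++ m) = word z l * word z m := by simp [word]

theorem word_ofFn (z : Fin N → B) {n : ℕ} (i : Fin n → Fin N) :
    word z (List.ofFn i) = (List.ofFn fun k => z (i k)).prod := by
  simp [word, List.map_ofFn, Function.comp_def]

variable [StarRing B]

theorem star_word (z : Fin N → B) (l : List (Fin N)) :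
    star (word z l) = word (fun i => star (z i)) l.reverse := by
  induction l with
  | nil => simp [word_nil]
  | cons i l ih => simp [word_cons, word_append, ih, word_nil]

theorem List.exists_eq_ofFn_of_length_eq {α : Type*} {n : ℕ} {l : List α} (hl : l.length = n) :
    ∃ f : Fin n → α, l = List.ofFn f := by
  subst hl
  exact ⟨l.get, (List.ofFn_get l).symm⟩

namespace IsHalfLiberated

variable {z : Fin N → B}

theorem commute_word (hz : IsHalfLiberated K z) {l m : List (Fin N)} (hl : l.length = K)
    (hm : m.length = K) : Commute (word z l) (word z m) := by
  obtain ⟨f, rfl⟩ := List.exists_eq_ofFn_of_length_eq hl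
  obtain ⟨g, rfl⟩ := List.exists_eq_ofFn_of_length_eq hm
  rw [word_ofFn, word_ofFn]
  exact hz.commute f g

/-- The adjoint reverses the word, which is harmless because the relation is imposed for all index
tuples. -/
theorem commute_word_star (hz : IsHalfLiberated K z) {l m : List (Fin N)} (hl : l.length = K)
    (hm : m.length = K) : Commute (word z l) (star (word z m)) := by
  rw [star_word]
  rw [← List.length_reverse] at hm
  obtain ⟨f, rfl⟩ := List.exists_eq_ofFn_of_length_eq hl
  obtain ⟨g, hg⟩ := List.exists_eq_ofFn_of_length_eq hm
  rw [hg, word_ofFn, word_ofFn]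
  exact hz.commute_star f g

/-- The generators satisfy the relations as soon as the words of length `K` commute among
themselves and with their adjoints. -/
theorem of_word (h₁ : ∑ i, z i * star (z i) = 1) (h₂ : ∑ i, star (z i) * z i = 1)
    (h₃ : ∀ l m : List (Fin N), l.length = K → m.length = K → Commute (word z l) (word z m))
    (h₄ : ∀ l m : List (Fin N), l.length = K → m.length = K →
      Commute (word z l) (star (word z m))) : IsHalfLiberated K z where
  sum_mul_star := h₁
  sum_star_mul := h₂
  commute f g := by
    rw [← word_ofFn, ← word_ofFn]
    exact h₃ _ _ (List.length_ofFn) (List.length_ofFn)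
  commute_star f g := by
    have h := h₄ (List.ofFn f) (List.ofFn g).reverse (List.length_ofFn) (by simp)
    rwa [star_word, List.reverse_reverse, word_ofFn, word_ofFn] at h

theorem sum_word_mul_star (hz : IsHalfLiberated K z) (n : ℕ) :
    ∑ f : Fin n → Fin N, word z (List.ofFn f) * star (word z (List.ofFn f)) = 1 := by
  induction n with
  | zero => simp [word_nil]
  | succ n ih =>
    rw [← (Fin.consEquiv fun _ => Fin N).sum_comp, Fintype.sum_prod_type, ← hz.sum_mul_star]
    refine Finset.sum_congr rfl fun i _ => ?_
    calc _ = z i * (∑ f : Fin n → Fin N, word z (List.ofFn f) * star (word z (List.ofFn f))) *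
          star (z i) := by
            simp [Finset.mul_sum, Finset.sum_mul, List.ofFn_succ, word_cons, mul_assoc,
              Fin.consEquiv]
      _ = _ := by rw [ih, mul_one]

theorem sum_star_word_mul (hz : IsHalfLiberated K z) (n : ℕ) :
    ∑ f : Fin n → Fin N, star (word z (List.ofFn f)) * word z (List.ofFn f) = 1 := by
  induction n with
  | zero => simp [word_nil]
  | succ n ih =>
    rw [← (Fin.consEquiv fun _ => Fin N).sum_comp, Fintype.sum_prod_type, Finset.sum_comm, ← ih]
    refine Finset.sum_congr rfl fun f _ => ?_
    -- The first letter of each word sits in the middle of `star w * w`, so the sum over it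
    -- collapses first, with the remaining word fixed.
    calc _ = star (word z (List.ofFn f)) * (∑ i, star (z i) * z i) * word z (List.ofFn f) := by
            simp [Finset.mul_sum, Finset.sum_mul, List.ofFn_succ, word_cons, mul_assoc,
              Fin.consEquiv]
      _ = _ := by rw [hz.sum_star_mul, mul_one]

end IsHalfLiberated

end Words

/-! ## The algebra generated by the words of length `K` -/

section BlockAlgebra

variable {N : ℕ} (K : ℕ) {B : Type*} [Ring B] [StarRing B] [Algebra ℂ B] [StarModule ℂ B]

/-- The `*`-algebra generated by the words of length `K`. -/
def blockAlgebra (z : Fin N → B) : StarSubalgebra ℂ B :=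
  StarAlgebra.adjoin ℂ {b | ∃ l : List (Fin N), l.length = K ∧ word z l = b}

variable {K} {z : Fin N → B}

theorem word_mem_blockAlgebra {l : List (Fin N)} (hl : l.length = K) :
    word z l ∈ blockAlgebra K z :=
  StarAlgebra.subset_adjoin ℂ _ ⟨l, hl, rfl⟩

theorem word_mem_blockAlgebra_of_dvd {l : List (Fin N)} (hl : K ∣ l.length) :
    word z l ∈ blockAlgebra K z := by
  obtain ⟨n, hn⟩ := hl
  induction n generalizing l with
  | zero =>
    obtain rfl : l = [] := List.length_eq_zero_iff.1 (by simpa using hn)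
    exact one_mem _
  | succ n ih =>
    rw [← List.take_append_drop K l, word_append]
    refine mul_mem (word_mem_blockAlgebra ?_) (ih ?_)
    · rw [List.length_take, hn]
      exact min_eq_left (Nat.le_mul_of_pos_right K n.succ_pos)
    · rw [List.length_drop, hn, Nat.mul_succ, Nat.add_sub_cancel]

namespace IsHalfLiberated

theorem isMulCommutative_blockAlgebra (hz : IsHalfLiberated K z) :
    IsMulCommutative (blockAlgebra K z) := by
  refine StarAlgebra.isMulCommutative_adjoin ℂ ?_ ?_
  · rintro _ ⟨l, hl, rfl⟩ _ ⟨m, hm, rfl⟩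
    exact hz.commute_word hl hm
  · rintro _ ⟨l, hl, rfl⟩ _ ⟨m, hm, rfl⟩
    exact hz.commute_word_star hl hm

theorem commute_of_mem (hz : IsHalfLiberated K z) {a b : B} (ha : a ∈ blockAlgebra K z)
    (hb : b ∈ blockAlgebra K z) : Commute a b := by
  have := hz.isMulCommutative_blockAlgebra
  exact congrArg Subtype.val (mul_comm' (⟨a, ha⟩ : blockAlgebra K z) ⟨b, hb⟩)

variable (K z) in
/-- The span of the products `a w` with `a` in the algebra generated by the words of length `K`
and `w` a word in the generators. -/
def _root_.blockSpan : Submodule ℂ B :=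
  Submodule.span ℂ {b | ∃ a ∈ blockAlgebra K z, ∃ l : List (Fin N), a * word z l = b}

theorem mul_mem_blockSpan {a b : B} (ha : a ∈ blockAlgebra K z) (hb : b ∈ blockSpan K z) :
    a * b ∈ blockSpan K z := by
  induction hb using Submodule.span_induction with
  | mem x hx =>
    obtain ⟨c, hc, l, rfl⟩ := hx
    exact Submodule.subset_span ⟨a * c, mul_mem ha hc, l, mul_assoc _ _ _⟩
  | zero => simp
  | add x y _ _ hx hy => rw [mul_add]; exact add_mem hx hy
  | smul r x _ hx => rw [mul_smul_comm]; exact Submodule.smul_mem _ _ hx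

variable [NeZero K]

/-- Inserting `1 = ∑ w w*` over the words `w` of length `K - 1` between the two letters completes
both sides to words of length `K`. -/
theorem mul_star_mem (hz : IsHalfLiberated K z) (i j : Fin N) :
    z i * star (z j) ∈ blockAlgebra K z := by
  have h : z i * star (z j) = ∑ f : Fin (K - 1) → Fin N,
      word z (i :: List.ofFn f) * star (word z (j :: List.ofFn f)) := by
    calc _ = z i * 1 * star (z j) := by rw [mul_one]
      _ = _ := by
        rw [← hz.sum_word_mul_star (K - 1)]
        simp [Finset.mul_sum, Finset.sum_mul, word_cons, mul_assoc]
  have hK : K - 1 + 1 = K := Nat.succ_pred_eq_of_ne_zero (NeZero.ne K)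
  rw [h]
  exact sum_mem fun f _ => mul_mem (word_mem_blockAlgebra (by simpa using hK))
    (star_mem (word_mem_blockAlgebra (by simpa using hK)))

theorem star_mul_mem (hz : IsHalfLiberated K z) (i j : Fin N) :
    star (z i) * z j ∈ blockAlgebra K z := by
  have h : star (z i) * z j = ∑ f : Fin (K - 1) → Fin N,
      star (word z (List.ofFn f ++ [i])) * word z (List.ofFn f ++ [j]) := by
    calc _ = star (z i) * 1 * z j := by rw [mul_one]
      _ = _ := by
        rw [← hz.sum_star_word_mul (K - 1)]
        simp [Finset.mul_sum, Finset.sum_mul, word_cons, word_nil, word_append, mul_assoc]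
  have hK : K - 1 + 1 = K := Nat.succ_pred_eq_of_ne_zero (NeZero.ne K)
  rw [h]
  exact sum_mem fun f _ => mul_mem (star_mem (word_mem_blockAlgebra (by simpa using hK)))
    (word_mem_blockAlgebra (by simpa using hK))

/-- Odd half-commutation of the generators. -/
theorem mul_star_mul_comm (hz : IsHalfLiberated K z) (i k j : Fin N) :
    z i * star (z k) * z j = z j * star (z k) * z i := by
  calc z i * star (z k) * z j
      -- Appending `∑ zₗ* zₗ = 1` creates two adjacent pairs from the block algebra, which commute.
      -- After that exchange the letters regroup into pairs `z* z`, which commute as well, and the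
      -- auxiliary letters meet again as `zₗ zₗ*`.
      = ∑ l, (z i * star (z k)) * (z j * star (z l)) * z l := by
        rw [← mul_one (z i * star (z k) * z j), ← hz.sum_star_mul, Finset.mul_sum]
        simp [mul_assoc]
    _ = ∑ l, z j * ((star (z l) * z i) * (star (z k) * z l)) := by
        refine Finset.sum_congr rfl fun l _ => ?_
        rw [(hz.commute_of_mem (hz.mul_star_mem i k) (hz.mul_star_mem j l)).eq]
        simp only [mul_assoc]
    _ = ∑ l, z j * star (z k) * (z l * star (z l)) * z i := by
        refine Finset.sum_congr rfl fun l _ => ?_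
        rw [(hz.commute_of_mem (hz.star_mul_mem l i) (hz.star_mul_mem k l)).eq]
        simp only [mul_assoc]
    _ = z j * star (z k) * z i := by
        rw [← Finset.sum_mul, ← Finset.mul_sum, hz.sum_mul_star, mul_one]

/-- Generators at distance `K` in a word may be exchanged. -/
theorem mul_word_mul_comm (hz : IsHalfLiberated K z) {m : List (Fin N)} (hm : m.length + 1 = K)
    (i j : Fin N) : z i * word z m * z j = z j * word z m * z i := by
  have hA : ∀ k, word z (k :: m) ∈ blockAlgebra K z := fun k =>
    word_mem_blockAlgebra (by simpa using hm)
  have key : ∀ i j, z i * word z m * z j = ∑ k, word z (k :: m) * (z i * star (z k) * z j) := by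
    -- Once `zᵢ zₖ*` is moved past the block word, `i` and `j` occur only in `zᵢ zₖ* zⱼ`, which is
    -- symmetric in them.
    intro i j
    calc z i * word z m * z j = z i * (∑ k, star (z k) * z k) * word z m * z j := by
          rw [hz.sum_star_mul, mul_one]
      _ = ∑ k, (z i * star (z k)) * word z (k :: m) * z j := by
          simp only [Finset.mul_sum, Finset.sum_mul, word_cons, mul_assoc]
      _ = _ := by
          refine Finset.sum_congr rfl fun k _ => ?_
          rw [(hz.commute_of_mem (hz.mul_star_mem i k) (hA k)).eq]
          simp only [mul_assoc]
  rw [key, key]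
  exact Finset.sum_congr rfl fun k _ => by rw [hz.mul_star_mul_comm]

/-- Letters in the same position of two words of length `K` may be exchanged. -/
theorem word_mul_word_swap (hz : IsHalfLiberated K z) {u v u' v' : List (Fin N)}
    (h : v.length + u'.length + 1 = K) (i j : Fin N) :
    word z (u ++ i :: v) * word z (u' ++ j :: v') =
      word z (u ++ j :: v) * word z (u' ++ i :: v') := by
  have hs := hz.mul_word_mul_comm (m := v ++ u') (by simpa using h) i j
  rw [word_append] at hs
  simp only [word_append, word_cons, mul_assoc] at hs ⊢
  calc _ = word z u * (z i * (word z v * (word z u' * z j))) * word z v' := by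
        simp only [mul_assoc]
    _ = _ := by rw [hs]; simp only [mul_assoc]

/-- This lets a generator pass a block coefficient. For a single word, prepending `zᵢ` shifts the
window of `K` letters and leaves a pair `zₖ zⱼ*`. Products follow by inserting `∑ zₖ* zₖ = 1`
between the factors. -/
theorem mul_mul_star_mem (hz : IsHalfLiberated K z) {a : B} (ha : a ∈ blockAlgebra K z) :
    ∀ i j, z i * a * star (z j) ∈ blockAlgebra K z := by
  induction ha using StarAlgebra.adjoin_induction with
  | mem x hx =>
    obtain ⟨l, hl, rfl⟩ := hx
    intro i j
    rcases List.eq_nil_or_concat l with rfl | ⟨m, k, rfl⟩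
    · exact absurd hl.symm (NeZero.ne K)
    · have h : z i * word z (m ++ [k]) * star (z j) = word z (i :: m) * (z k * star (z j)) := by
        simp [word_append, word_cons, word_nil, mul_assoc]
      rw [List.concat_eq_append, h]
      exact mul_mem (word_mem_blockAlgebra (by simpa using hl)) (hz.mul_star_mem k j)
  | algebraMap r =>
    intro i j
    rw [← Algebra.commutes, mul_assoc, ← Algebra.smul_def]
    exact SMulMemClass.smul_mem r (hz.mul_star_mem i j)
  | add x y _ _ hx hy =>
    intro i j
    rw [mul_add, add_mul]
    exact add_mem (hx i j) (hy i j)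
  | mul x y _ _ hx hy =>
    intro i j
    have h : z i * (x * y) * star (z j) = ∑ k, z i * x * star (z k) * (z k * y * star (z j)) := by
      calc _ = z i * x * 1 * y * star (z j) := by simp only [mul_one, mul_assoc]
        _ = _ := by
          rw [← hz.sum_star_mul]
          simp only [Finset.mul_sum, Finset.sum_mul, mul_assoc]
    rw [h]
    exact sum_mem fun k _ => mul_mem (hx i k) (hy k j)
  | star x _ hx =>
    intro i j
    have h := star_mem (hx j i)
    simpa [mul_assoc] using h

theorem gen_mul_mem_blockSpan (hz : IsHalfLiberated K z) (i : Fin N) {b : B}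
    (hb : b ∈ blockSpan K z) : z i * b ∈ blockSpan K z := by
  induction hb using Submodule.span_induction with
  | mem x hx =>
    obtain ⟨c, hc, l, rfl⟩ := hx
    have h : z i * (c * word z l) = ∑ k, z i * c * star (z k) * word z (k :: l) := by
      calc _ = z i * c * 1 * word z l := by simp only [mul_one, mul_assoc]
        _ = _ := by
          rw [← hz.sum_star_mul]
          simp only [Finset.mul_sum, Finset.sum_mul, word_cons, mul_assoc]
    rw [h]
    exact sum_mem fun k _ => Submodule.subset_span ⟨_, hz.mul_mul_star_mem hc i k, k :: l, rfl⟩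
  | zero => simp
  | add x y _ _ hx hy => rw [mul_add]; exact add_mem hx hy
  | smul r x _ hx => rw [mul_smul_comm]; exact Submodule.smul_mem _ _ hx

theorem word_mul_mem_blockSpan (hz : IsHalfLiberated K z) (l : List (Fin N)) {b : B}
    (hb : b ∈ blockSpan K z) : word z l * b ∈ blockSpan K z := by
  induction l with
  | nil => simpa [word_nil] using hb
  | cons i l ih =>
    rw [word_cons, mul_assoc]
    exact hz.gen_mul_mem_blockSpan i ih

/-- Since `zᵢ* = ∑ w (zᵢ w)*` over the words `w` of length `K - 1`, an adjoint letter is a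
combination of words times block elements. -/
theorem star_gen_mul_mem_blockSpan (hz : IsHalfLiberated K z) (i : Fin N) {b : B}
    (hb : b ∈ blockSpan K z) : star (z i) * b ∈ blockSpan K z := by
  have hK : K - 1 + 1 = K := Nat.succ_pred_eq_of_ne_zero (NeZero.ne K)
  have h : star (z i) * b = ∑ f : Fin (K - 1) → Fin N,
      word z (List.ofFn f) * (star (word z (i :: List.ofFn f)) * b) := by
    calc _ = 1 * star (z i) * b := by rw [one_mul]
      _ = _ := by
        rw [← hz.sum_word_mul_star (K - 1)]
        simp [Finset.sum_mul, word_cons, mul_assoc]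
  rw [h]
  exact sum_mem fun f _ => hz.word_mul_mem_blockSpan _
    (mul_mem_blockSpan (star_mem (word_mem_blockAlgebra (by simpa using hK))) hb)

/-- All `*`-polynomials in the generators lie in the block span. -/
theorem eval_mem_blockSpan (hz : IsHalfLiberated K z) (p : FreeStarAlg N) :
    FreeStarAlg.eval z p ∈ blockSpan K z := by
  -- Stability of the span under left multiplication passes to products of polynomials, whereas
  -- plain membership would not.
  suffices h : ∀ b ∈ blockSpan K z, FreeStarAlg.eval z p * b ∈ blockSpan K z by
    have h1 := h 1 (Submodule.subset_span ⟨1, one_mem _, [], by simp [word_nil]⟩)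
    rwa [mul_one] at h1
  induction p using FreeStarAlg.induction with
  | hs c =>
    intro b hb
    rw [AlgHomClass.commutes, ← Algebra.smul_def]
    exact Submodule.smul_mem _ _ hb
  | hl x =>
    intro b hb
    rw [FreeStarAlg.eval_letter]
    cases x with
    | inl i => exact hz.gen_mul_mem_blockSpan i hb
    | inr i => exact hz.star_gen_mul_mem_blockSpan i hb
  | hm p q hp hq =>
    intro b hb
    rw [map_mul, mul_assoc]
    exact hp _ (hq _ hb)
  | ha p q hp hq =>
    intro b hb
    rw [map_add, add_mul]
    exact add_mem (hp _ hb) (hq _ hb)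

end IsHalfLiberated

end BlockAlgebra

/-! ## The universal property of the half-liberated sphere -/

theorem map_word {N : ℕ} {B C F : Type*} [Ring B] [Ring C] [FunLike F B C] [MonoidHomClass F B C]
    (φ : F) (z : Fin N → B) (l : List (Fin N)) : φ (word z l) = word (fun i => φ (z i)) l := by
  simp [word, map_list_prod, List.map_map, Function.comp_def]

theorem word_smul {N : ℕ} {B : Type*} [Ring B] [Algebra ℂ B] (c : ℂ) (z : Fin N → B)
    (l : List (Fin N)) : word (fun i => c • z i) l = c ^ l.length • word z l := by
  induction l with
  | nil => simp [word_nil]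
  | cons i l ih => simp [word_cons, ih, smul_smul, pow_succ]

/-- The relations are homogeneous up to a phase; this produces the gauge automorphisms. -/
theorem IsHalfLiberated.smul {N K : ℕ} {B : Type*} [Ring B] [StarRing B] [Algebra ℂ B]
    [StarModule ℂ B] {z : Fin N → B} (hz : IsHalfLiberated K z) {c : ℂ} (hc : ‖c‖ = 1) :
    IsHalfLiberated K fun i => c • z i := by
  have hcc : c * conj c = 1 := by simp [Complex.mul_conj', hc]
  refine .of_word ?_ ?_ (fun l m hl hm => ?_) (fun l m hl hm => ?_)
  · simpa [smul_smul, mul_comm _ c, hcc] using hz.sum_mul_star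
  · simpa [smul_smul, mul_comm _ c, hcc] using hz.sum_star_mul
  · rw [word_smul, word_smul]
    exact ((hz.commute_word hl hm).smul_left _).smul_right _
  · rw [word_smul, word_smul, star_smul]
    exact ((hz.commute_word_star hl hm).smul_left _).smul_right _

namespace HLPoly

variable {N K : ℕ}

/-- The generators of the algebra of `*`-polynomials. -/
def gen (i : Fin N) : HLPoly N K := (FreeStarAlg.letter (Sum.inl i) : FreeStarAlg N)

theorem eval_gen {B : Type*} [Ring B] [StarRing B] [Algebra ℂ B] [StarModule ℂ B]
    (z : Fin N → B) (i : Fin N) : eval z (gen i : HLPoly N K) = z i :=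
  FreeStarAlg.eval_letter z (Sum.inl i)

theorem eval_star {B : Type*} [Ring B] [StarRing B] [Algebra ℂ B] [StarModule ℂ B]
    (z : Fin N → B) (p : HLPoly N K) : eval z (star p) = star (eval z p) :=
  map_star (eval z) p

theorem starAlgHom_ext {B : Type*} [Ring B] [StarRing B] [Algebra ℂ B]
    {φ ψ : HLPoly N K →⋆ₐ[ℂ] B} (h : ∀ i, φ (gen i) = ψ (gen i)) : φ = ψ := by
  ext p
  induction p using FreeStarAlg.induction with
  | hs c => exact (AlgHomClass.commutes φ c).trans (AlgHomClass.commutes ψ c).symm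
  | hl x =>
    cases x with
    | inl i => exact h i
    | inr i =>
      have hs : (FreeStarAlg.letter (Sum.inr i) : FreeStarAlg N) = star (gen i : HLPoly N K) :=
        (FreeStarAlg.star_letter (Sum.inl i)).symm
      refine (congrArg φ hs).trans (Eq.trans ?_ (congrArg ψ hs).symm)
      rw [map_star, map_star, h]
  | hm a b ha hb => exact (map_mul φ a b).trans ((congrArg₂ _ ha hb).trans (map_mul ψ a b).symm)
  | ha a b ha hb => exact (map_add φ a b).trans ((congrArg₂ _ ha hb).trans (map_add ψ a b).symm)

end HLPoly

namespace HLSphere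

variable {N K : ℕ}

/-- The class map as a `*`-homomorphism. -/
def ofPolyHom (N K : ℕ) : HLPoly N K →⋆ₐ[ℂ] HLSphere N K where
  toFun := ofPoly
  map_one' := rfl
  map_mul' := ofPoly_mul
  map_zero' := rfl
  map_add' := ofPoly_add
  commutes' c := by
    rw [Algebra.algebraMap_eq_smul_one, Algebra.algebraMap_eq_smul_one, ofPoly_smul]
    rfl
  map_star' p := (star_ofPoly p).symm

theorem ofPolyHom_apply (p : HLPoly N K) : ofPolyHom N K p = ofPoly p := rfl

theorem ofPolyHom_gen (i : Fin N) : ofPolyHom N K (HLPoly.gen i) = z i := rfl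

/-- The universal seminorm of `p - q` is a supremum of norms that all vanish. -/
theorem ofPolyHom_eq_of_eval_eq {p q : HLPoly N K}
    (h : ∀ (B : Type) [CStarAlgebra B] (z : Fin N → B), IsHalfLiberated K z →
      HLPoly.eval z p = HLPoly.eval z q) : ofPolyHom N K p = ofPolyHom N K q := by
  rw [← sub_eq_zero, ← map_sub, ← norm_eq_zero, ofPolyHom_apply, norm_ofPoly]
  refine le_antisymm (HLPoly.norm_le_of le_rfl fun B _ z hz => ?_) (norm_nonneg _)
  rw [map_sub, h B z hz, sub_self, norm_zero]

theorem isHalfLiberated_z (N K : ℕ) : IsHalfLiberated K (z : Fin N → HLSphere N K) := by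
  have hw : ∀ l : List (Fin N), word (z : Fin N → HLSphere N K) l =
      ofPolyHom N K (word HLPoly.gen l) := fun l => (map_word (ofPolyHom N K) _ l).symm
  refine .of_word ?_ ?_ (fun l m hl hm => ?_) (fun l m hl hm => ?_)
  · simp only [← ofPolyHom_gen, ← map_star, ← map_mul, ← map_sum, ← map_one (ofPolyHom N K)]
    refine ofPolyHom_eq_of_eval_eq fun B _ z hz => ?_
    simpa [HLPoly.eval_gen, HLPoly.eval_star] using hz.sum_mul_star
  · simp only [← ofPolyHom_gen, ← map_star, ← map_mul, ← map_sum, ← map_one (ofPolyHom N K)]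
    refine ofPolyHom_eq_of_eval_eq fun B _ z hz => ?_
    simpa [HLPoly.eval_gen, HLPoly.eval_star] using hz.sum_star_mul
  · rw [hw, hw, commute_iff_eq, ← map_mul, ← map_mul]
    refine ofPolyHom_eq_of_eval_eq fun B _ z hz => ?_
    simpa [HLPoly.eval_gen, map_word] using (hz.commute_word hl hm).eq
  · rw [hw, hw, commute_iff_eq, ← map_star, ← map_mul, ← map_mul]
    refine ofPolyHom_eq_of_eval_eq fun B _ z hz => ?_
    simpa [HLPoly.eval_gen, HLPoly.eval_star, map_word] using (hz.commute_word_star hl hm).eq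

theorem eval_z (p : HLPoly N K) : HLPoly.eval z p = ofPoly p :=
  DFunLike.congr_fun (HLPoly.starAlgHom_ext (ψ := ofPolyHom N K) fun i => HLPoly.eval_gen _ i) p

section Lift

variable {B : Type} [CStarAlgebra B] {w : Fin N → B}

/-- The map underlying the universal property. -/
def liftFun (w : Fin N → B) : HLSphere N K → B :=
  UniformSpace.Completion.extension (HLPoly.eval w : HLPoly N K → B)

theorem continuous_liftFun (w : Fin N → B) : Continuous (liftFun w : HLSphere N K → B) :=
  UniformSpace.Completion.continuous_extension

theorem liftFun_ofPoly (hw : IsHalfLiberated K w) (p : HLPoly N K) :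
    liftFun w (ofPoly p) = HLPoly.eval w p := by
  -- The universal seminorm dominates the norm in every solution, so evaluation is contractive and
  -- extends to the completion.
  have hl : LipschitzWith 1 (HLPoly.eval w : HLPoly N K → B) :=
    AddMonoidHomClass.lipschitz_of_bound_nnnorm (HLPoly.eval w : HLPoly N K →⋆ₐ[ℂ] B) 1 fun p => by
      rw [one_mul]
      exact HLPoly.norm_eval_le p hw
  exact UniformSpace.Completion.extension_coe hl.uniformContinuous p

/-- The `*`-homomorphism determined by a solution of the defining relations. -/
def lift (hw : IsHalfLiberated K w) : HLSphere N K →⋆ₐ[ℂ] B where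
  toFun := liftFun w
  map_one' := (liftFun_ofPoly hw 1).trans (map_one _)
  map_zero' := (liftFun_ofPoly hw 0).trans (map_zero _)
  map_mul' x y := by
    refine denseRange_ofPoly.induction_on₂
      (p := fun x y : HLSphere N K => liftFun w (x * y) = liftFun w x * liftFun w y)
      ?_ (fun p q => ?_) x y
    · exact isClosed_eq ((continuous_liftFun w).comp continuous_mul)
        (((continuous_liftFun w).comp continuous_fst).mul
          ((continuous_liftFun w).comp continuous_snd))
    · rw [← ofPoly_mul, liftFun_ofPoly hw, liftFun_ofPoly hw, liftFun_ofPoly hw, map_mul]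
  map_add' x y := by
    refine denseRange_ofPoly.induction_on₂
      (p := fun x y : HLSphere N K => liftFun w (x + y) = liftFun w x + liftFun w y)
      ?_ (fun p q => ?_) x y
    · exact isClosed_eq ((continuous_liftFun w).comp continuous_add)
        (((continuous_liftFun w).comp continuous_fst).add
          ((continuous_liftFun w).comp continuous_snd))
    · rw [← ofPoly_add, liftFun_ofPoly hw, liftFun_ofPoly hw, liftFun_ofPoly hw, map_add]
  commutes' c := by
    rw [← AlgHomClass.commutes (ofPolyHom N K) c, ofPolyHom_apply]
    exact (liftFun_ofPoly hw _).trans (AlgHomClass.commutes (HLPoly.eval w) c)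
  map_star' x := by
    refine denseRange_ofPoly.induction_on
      (p := fun x : HLSphere N K => liftFun w (star x) = star (liftFun w x)) x
      (isClosed_eq ((continuous_liftFun w).comp continuous_star)
        (continuous_star.comp (continuous_liftFun w))) fun p => ?_
    rw [star_ofPoly, liftFun_ofPoly hw, liftFun_ofPoly hw, map_star]

theorem lift_z (hw : IsHalfLiberated K w) (i : Fin N) : lift hw (z i) = w i :=
  (liftFun_ofPoly hw _).trans (HLPoly.eval_gen w i)

theorem continuous_lift (hw : IsHalfLiberated K w) : Continuous (lift hw) := continuous_liftFun w

end Lift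

theorem starAlgHom_ext {B : Type*} [Ring B] [StarRing B] [Algebra ℂ B] [TopologicalSpace B]
    [T2Space B] {φ ψ : HLSphere N K →⋆ₐ[ℂ] B} (hφ : Continuous φ) (hψ : Continuous ψ)
    (h : ∀ i, φ (z i) = ψ (z i)) : φ = ψ := by
  have hp : φ.comp (ofPolyHom N K) = ψ.comp (ofPolyHom N K) := HLPoly.starAlgHom_ext h
  exact DFunLike.coe_injective
    (denseRange_ofPoly.equalizer hφ hψ (funext fun p => DFunLike.congr_fun hp p))

theorem dense_blockSpan (N K : ℕ) [NeZero K] :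
    Dense (blockSpan K (z : Fin N → HLSphere N K) : Set (HLSphere N K)) := by
  refine denseRange_ofPoly.mono ?_
  rintro _ ⟨p, rfl⟩
  rw [← eval_z]
  exact (isHalfLiberated_z N K).eval_mem_blockSpan p

/-! ## The gauge action and the expectation onto its fixed points -/

section Gauge

/-- The standard primitive `K`-th root of unity. -/
def root (K : ℕ) : ℂ := Complex.exp (2 * Real.pi * Complex.I / K)

theorem isPrimitiveRoot_root (K : ℕ) [NeZero K] : IsPrimitiveRoot (root K) K :=
  Complex.isPrimitiveRoot_exp K (NeZero.ne K)

theorem norm_root_pow (K : ℕ) [NeZero K] (k : ℕ) : ‖root K ^ k‖ = 1 := by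
  rw [norm_pow, (isPrimitiveRoot_root K).norm'_eq_one (NeZero.ne K), one_pow]

variable [NeZero K]

variable (N K) in
/-- The gauge automorphism multiplying each generator by the `k`-th power of the primitive root. -/
def gauge (k : ℕ) : HLSphere N K →⋆ₐ[ℂ] HLSphere N K :=
  lift ((isHalfLiberated_z N K).smul (norm_root_pow K k))

theorem continuous_gauge (k : ℕ) : Continuous (gauge N K k) := continuous_lift _

theorem gauge_word (k : ℕ) (l : List (Fin N)) :
    gauge N K k (word z l) = (root K ^ l.length) ^ k • word z l := by
  rw [map_word]
  simp only [gauge, lift_z]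
  rw [word_smul, pow_right_comm]

theorem gauge_zero (x : HLSphere N K) : gauge N K 0 x = x := by
  refine DFunLike.congr_fun (starAlgHom_ext (φ := gauge N K 0) (ψ := StarAlgHom.id ℂ _)
    (continuous_gauge 0) continuous_id fun i => ?_) x
  simp [gauge, lift_z]

theorem gauge_of_mem (k : ℕ) {a : HLSphere N K} (ha : a ∈ blockAlgebra K z) :
    gauge N K k a = a := by
  have h : blockAlgebra K (z : Fin N → HLSphere N K) ≤
      StarAlgHom.equalizer (gauge N K k) (StarAlgHom.id ℂ _) := by
    refine StarAlgHom.adjoin_le_equalizer _ _ ?_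
    rintro _ ⟨l, hl, rfl⟩
    rw [gauge_word, hl, (isPrimitiveRoot_root K).pow_eq_one, one_pow, one_smul]
    rfl
  exact h ha

variable (N K) in
/-- The average over the gauge action of the `K`-th roots of unity. -/
def expectation : HLSphere N K →ₗ[ℂ] HLSphere N K :=
  (K : ℂ)⁻¹ • ∑ k ∈ Finset.range K, (gauge N K k).toAlgHom.toLinearMap

theorem expectation_apply (x : HLSphere N K) :
    expectation N K x = (K : ℂ)⁻¹ • ∑ k ∈ Finset.range K, gauge N K k x := by
  simp [expectation]

theorem continuous_expectation : Continuous (expectation N K) := by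
  have h : (expectation N K : HLSphere N K → HLSphere N K) =
      fun x => (K : ℂ)⁻¹ • ∑ k ∈ Finset.range K, gauge N K k x := funext expectation_apply
  rw [h]
  have hs : Continuous fun x => ∑ k ∈ Finset.range K, gauge N K k x :=
    continuous_finsetSum _ fun k _ => continuous_gauge k
  exact hs.const_smul (K : ℂ)⁻¹

/-- The gauge action fixes `a` and multiplies the word by a power of `ζ^{|l|}`; summing over the
group gives a geometric sum that vanishes unless `ζ^{|l|} = 1`. -/
theorem expectation_mul_word {a : HLSphere N K} (ha : a ∈ blockAlgebra K z) (l : List (Fin N)) :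
    expectation N K (a * word z l) = if K ∣ l.length then a * word z l else 0 := by
  have hK : (K : ℂ) ≠ 0 := Nat.cast_ne_zero.2 (NeZero.ne K)
  have h : ∀ k, gauge N K k (a * word z l) = (root K ^ l.length) ^ k • (a * word z l) := fun k => by
    rw [map_mul, gauge_of_mem k ha, gauge_word, mul_smul_comm]
  simp only [expectation_apply, h, ← Finset.sum_smul, smul_smul]
  split_ifs with hd
  · rw [(isPrimitiveRoot_root K).pow_eq_one_iff_dvd _ |>.2 hd]
    simp [hK]
  · have hne : root K ^ l.length ≠ 1 := fun e =>
      hd ((isPrimitiveRoot_root K).dvd_of_pow_eq_one _ e)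
    rw [geom_sum_eq hne, pow_right_comm, (isPrimitiveRoot_root K).pow_eq_one, one_pow]
    simp

theorem expectation_mem (x : HLSphere N K) :
    expectation N K x ∈ (blockAlgebra K z).topologicalClosure := by
  have hc : IsClosed {x : HLSphere N K |
      expectation N K x ∈ (blockAlgebra K z).topologicalClosure} :=
    (StarSubalgebra.isClosed_topologicalClosure _).preimage continuous_expectation
  refine hc.closure_subset_iff.2 (fun y hy => ?_) (dense_blockSpan N K x)
  refine StarSubalgebra.le_topologicalClosure _ ?_
  induction hy using Submodule.span_induction with
  | mem y hy =>
    obtain ⟨a, ha, l, rfl⟩ := hy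
    rw [expectation_mul_word ha]
    split_ifs with hd
    · exact mul_mem ha (word_mem_blockAlgebra_of_dvd hd)
    · exact zero_mem _
  | zero => rw [map_zero]; exact zero_mem _
  | add y y' _ _ hy hy' => rw [map_add]; exact add_mem hy hy'
  | smul r y _ hy => rw [map_smul]; exact SMulMemClass.smul_mem r hy

/-- The expectation is faithful. -/
theorem eq_zero_of_expectation_star_mul_self {x : HLSphere N K}
    (h : expectation N K (star x * x) = 0) : x = 0 := by
  let _ := CStarAlgebra.spectralOrder (HLSphere N K)
  have := CStarAlgebra.spectralOrderedRing (HLSphere N K)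
  have hK : (K : ℂ)⁻¹ ≠ 0 := inv_ne_zero (Nat.cast_ne_zero.2 (NeZero.ne K))
  rw [expectation_apply, smul_eq_zero_iff_right hK] at h
  -- A vanishing sum of positive elements has vanishing terms, and the term for `k = 0` is `star x *
  -- x` itself.
  have h0 := (Finset.sum_eq_zero_iff_of_nonneg fun k _ => ?_).1 h 0
    (Finset.mem_range.2 (NeZero.pos K))
  · rw [gauge_zero] at h0
    exact CStarRing.star_mul_self_eq_zero_iff x |>.1 h0
  · rw [map_mul, map_star]
    exact star_mul_self_nonneg _

end Gauge

end HLSphere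

/-! ## Coefficients in crossed products -/

namespace CrossedProduct

variable {G A : Type*} [AddGroup G] [CStarAlgebra A] {α : Multiplicative G →* (A ≃⋆ₐ[ℂ] A)}

theorem coeff_star (x : CrossedProduct α) (g : G) :
    (star x).coeff g = act α g (star (x.coeff (-g))) := rfl

theorem coeff_tmul [DecidableEq G] (a : A) (g : G) :
    (tmul a g : CrossedProduct α).coeff = Pi.single g a := rfl

theorem coeff_mul [Fintype G] (x y : CrossedProduct α) (h : G) :
    (x * y).coeff h = ∑ g, x.coeff g * act α g (y.coeff (-g + h)) := rfl

theorem star_tmul [DecidableEq G] (a : A) (g : G) :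
    star (tmul a g : CrossedProduct α) = tmul (act α (-g) (star a)) (-g) := by
  ext k
  rw [coeff_star, coeff_tmul, coeff_tmul]
  by_cases hk : k = -g
  · subst hk
    simp
  · have hk' : -k ≠ g := fun e => hk (by rw [← e, neg_neg])
    simp [hk, hk']

/-- If `x` is supported at the neutral element, then it acts on coefficients by
multiplication. -/
theorem coeff_mul_of_support [Fintype G] {x : CrossedProduct α} (hx : ∀ g, g ≠ 0 → x.coeff g = 0)
    (y : CrossedProduct α) (g : G) : (x * y).coeff g = x.coeff 0 * y.coeff g := by
  rw [coeff_mul, Finset.sum_eq_single 0]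
  · simp [act_zero]
  · intro g' _ hg'
    rw [hx g' hg', zero_mul]
  · simp

variable [Fintype G] [DecidableEq G]

theorem coeff_algebraMap (r : ℂ) (g : G) :
    (algebraMap ℂ (CrossedProduct α) r).coeff g = r • (Pi.single 0 1 : G → A) g := by
  rw [Algebra.algebraMap_eq_smul_one]
  rfl

theorem tmul_mul_tmul (a b : A) (g h : G) :
    (tmul a g * tmul b h : CrossedProduct α) = tmul (a * act α g b) (g + h) := by
  ext k
  rw [coeff_mul, Finset.sum_eq_single g]
  · by_cases hk : k = g + h
    · subst hk
      simp [coeff_tmul]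
    · have hk' : -g + k ≠ h := fun e => hk (by rw [← e, add_neg_cancel_left])
      simp [coeff_tmul, hk, hk']
  · intro g' _ hg'
    simp [coeff_tmul, hg']
  · simp

theorem sum_tmul {ι : Type*} (s : Finset ι) (f : ι → A) (g : G) :
    (∑ i ∈ s, tmul (f i) g : CrossedProduct α) = tmul (∑ i ∈ s, f i) g := by
  induction s using Finset.cons_induction with
  | empty => ext k; exact (congrFun (Pi.single_zero (M := fun _ : G => A) g) k).symm
  | cons i s hi ih =>
    rw [Finset.sum_cons, Finset.sum_cons, ih]
    ext k
    exact (congrFun (Pi.single_add (f := fun _ : G => A) g _ _) k).symm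

theorem continuous_coeff (g : G) : Continuous fun x : CrossedProduct α => x.coeff g := by
  let _ := CStarAlgebra.spectralOrder A
  have := CStarAlgebra.spectralOrderedRing A
  have hev : Continuous fun M : CStarMatrix G G A => M 0 g :=
    (continuous_apply g).comp (continuous_apply (A := fun _ : G => G → A) 0)
  have h : (fun x : CrossedProduct α => x.coeff g) = fun x => toMatrix α x 0 g := by
    funext x
    change _ = act α 0 (x.coeff (-0 + g))
    simp [act_zero]
  rw [h]
  exact hev.comp (isometry_toMatrix (α := α)).continuous

end CrossedProduct

/-! ## The matrix model -/

section Model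

open CrossedProduct

variable {N K : ℕ}

theorem act_coordFun [NeZero K] (i : Fin N) (g c : ZMod K) :
    act (cyclicAction N K) g (coordFun i c) = coordFun i (c + g) := rfl

/-- The monomial `a_{l₁, s} a_{l₂, s + 1} ⋯` in the coordinate functions. -/
def wordFun : ZMod K → List (Fin N) → C(SpherePower N K, ℂ)
  | _, [] => 1
  | s, i :: l => coordFun i s * wordFun (s + 1) l

theorem act_wordFun [NeZero K] (g s : ZMod K) (l : List (Fin N)) :
    act (cyclicAction N K) g (wordFun s l) = wordFun (s + g) l := by
  induction l generalizing s with
  | nil => simp [wordFun]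
  | cons i l ih => simp [wordFun, ih, act_coordFun, add_right_comm]

theorem wordFun_ofFn_apply (x : SpherePower N K) {n : ℕ} (f : Fin n → Fin N) (s : ZMod K) :
    wordFun s (List.ofFn f) x =
      ∏ k : Fin n, (x (s + (k : ℕ)) : EuclideanSpace ℂ (Fin N)) (f k) := by
  induction n generalizing s with
  | zero => simp [wordFun]
  | succ n ih =>
    rw [List.ofFn_succ, Fin.prod_univ_succ, wordFun, ContinuousMap.mul_apply, ih]
    simp [coordFun, add_comm, add_left_comm]

theorem sum_coordFun_mul_star (c : ZMod K) :
    ∑ i : Fin N, coordFun i c * star (coordFun i c) = (1 : C(SpherePower N K, ℂ)) := by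
  ext x
  have h : ‖(x c : EuclideanSpace ℂ (Fin N))‖ = 1 := mem_sphere_zero_iff_norm.1 (x c).2
  have h2 : (∑ i, ‖(x c : EuclideanSpace ℂ (Fin N)) i‖ ^ 2 : ℝ) = 1 := by
    rw [← EuclideanSpace.norm_sq_eq, h, one_pow]
  simp only [ContinuousMap.sum_apply, ContinuousMap.mul_apply, ContinuousMap.star_apply,
    ContinuousMap.one_apply, coordFun, ContinuousMap.coe_mk, RCLike.star_def, Complex.mul_conj']
  exact_mod_cast h2

variable [NeZero K]

/-- The images `a_{i,0} ⊗ τ` of the generators in the crossed product. -/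
def modelGen (N K : ℕ) [NeZero K] (i : Fin N) : CrossedProduct (cyclicAction N K) :=
  tmul (coordFun i 0) 1

theorem word_modelGen (l : List (Fin N)) :
    word (modelGen N K) l = tmul (wordFun 0 l) (l.length : ZMod K) := by
  induction l with
  | nil => simp [word_nil, wordFun]; rfl
  | cons i l ih =>
    rw [word_cons, ih, modelGen, tmul_mul_tmul, act_wordFun, wordFun, List.length_cons]
    simp [add_comm]

/-- Words of length `K` have degree `K = 0`, hence lie with their adjoints in the commutative
algebra of functions; the sphere relations hold pointwise in one factor. -/
theorem isHalfLiberated_modelGen (N K : ℕ) [NeZero K] : IsHalfLiberated K (modelGen N K) := by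
  refine .of_word ?_ ?_ (fun l m hl hm => ?_) (fun l m hl hm => ?_)
  · simp only [modelGen, star_tmul, tmul_mul_tmul, act_act, add_neg_cancel, act_zero,
      sum_tmul, sum_coordFun_mul_star]
    rfl
  · simp only [modelGen, star_tmul, tmul_mul_tmul, neg_add_cancel, ← map_mul, sum_tmul,
      ← map_sum, mul_comm (star _), sum_coordFun_mul_star, map_one]
    rfl
  · rw [commute_iff_eq, word_modelGen, word_modelGen, hl, hm, ZMod.natCast_self]
    simp only [tmul_mul_tmul, act_zero, mul_comm]
  · rw [commute_iff_eq, word_modelGen, word_modelGen, hl, hm, ZMod.natCast_self, star_tmul]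
    simp only [tmul_mul_tmul, act_zero, neg_zero, mul_comm]

namespace HLSphere

variable (N K) in
/-- The representation of the half-liberated sphere in the crossed product. -/
def model : HLSphere N K →⋆ₐ[ℂ] CrossedProduct (cyclicAction N K) :=
  lift (isHalfLiberated_modelGen N K)

theorem model_z (i : Fin N) : model N K (z i) = tmul (coordFun i 0) 1 := lift_z _ i

theorem continuous_model : Continuous (model N K) := continuous_lift _

theorem model_word (l : List (Fin N)) :
    model N K (word z l) = tmul (wordFun 0 l) (l.length : ZMod K) := by
  rw [map_word]
  simp only [model, lift_z]
  exact word_modelGen l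

theorem coeff_model_of_mem {a : HLSphere N K} (ha : a ∈ blockAlgebra K z) :
    ∀ g, g ≠ 0 → (model N K a).coeff g = 0 := by
  induction ha using StarAlgebra.adjoin_induction with
  | mem x hx =>
    obtain ⟨l, hl, rfl⟩ := hx
    intro g hg
    rw [model_word, hl, ZMod.natCast_self, coeff_tmul, Pi.single_eq_of_ne hg]
  | algebraMap r =>
    intro g hg
    rw [AlgHomClass.commutes, coeff_algebraMap, Pi.single_eq_of_ne hg, smul_zero]
  | add x y _ _ hx hy =>
    intro g hg
    rw [map_add]
    change (model N K x).coeff g + (model N K y).coeff g = 0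
    rw [hx g hg, hy g hg, add_zero]
  | mul x y _ _ hx hy =>
    intro g hg
    rw [map_mul, coeff_mul_of_support hx, hy g hg, mul_zero]
  | star x _ hx =>
    intro g hg
    rw [map_star, coeff_star, hx _ (neg_ne_zero.2 hg), star_zero, map_zero]

/-- The expectation corresponds to taking the coefficient at the neutral element. -/
theorem coeff_model_expectation (x : HLSphere N K) :
    (model N K (expectation N K x)).coeff 0 = (model N K x).coeff 0 := by
  have hc : Continuous fun x => (model N K x).coeff 0 := (continuous_coeff 0).comp continuous_model
  have hcl : IsClosed {x : HLSphere N K |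
      (model N K (expectation N K x)).coeff 0 = (model N K x).coeff 0} :=
    isClosed_eq (hc.comp continuous_expectation) hc
  refine hcl.closure_subset_iff.2 (fun y hy => ?_) (dense_blockSpan N K x)
  change (model N K (expectation N K y)).coeff 0 = (model N K y).coeff 0
  induction hy using Submodule.span_induction with
  | mem y hy =>
    obtain ⟨a, ha, l, rfl⟩ := hy
    rw [expectation_mul_word ha]
    split_ifs with hd
    · rfl
    -- Multiplication by a degree-zero element preserves degree, and the word has nonzero degree, so
    -- there is no coefficient at `0`.
    · have hl : (0 : ZMod K) ≠ (l.length : ZMod K) := fun e =>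
        hd ((ZMod.natCast_eq_zero_iff _ _).1 e.symm)
      rw [map_mul, coeff_mul_of_support (coeff_model_of_mem ha), model_word, coeff_tmul,
        Pi.single_eq_of_ne hl, mul_zero, map_zero]
      rfl
  | zero => simp only [map_zero]
  | add y y' _ _ hy hy' =>
    simp only [map_add]
    exact congrArg₂ (· + ·) hy hy'
  | smul r y _ hy =>
    simp only [map_smul]
    exact congrArg (r • ·) hy

end HLSphere

end Model

/-! ## Tensors of rank one -/

section RankOne

variable {ι α : Type*} [DecidableEq ι]

/-- A function on a product which is invariant under exchanging coordinates in pairs of arguments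
is, up to normalization, a product of functions of one coordinate. -/
theorem mul_pow_card_eq_prod_update {T : (ι → α) → ℂ}
    (hT : ∀ I J c, T I * T J = T (Function.update I c (J c)) * T (Function.update J c (I c)))
    (J I : ι → α) (s : Finset ι) :
    T (s.piecewise I J) * T J ^ s.card = T J * ∏ c ∈ s, T (Function.update J c (I c)) := by
  induction s using Finset.induction_on with
  | empty => simp
  | insert c s hc ih =>
    -- Exchanging coordinate `c` with `J` turns the first argument into `s.piecewise I J`, the case
    -- covered by `ih`, and splits off the new factor.
    have h := hT ((insert c s).piecewise I J) J c
    rw [Finset.piecewise_insert, Function.update_self, Function.update_idem,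
      ← Finset.piecewise_eq_of_notMem s I J hc, Function.update_eq_self] at h
    rw [Finset.piecewise_insert, Finset.card_insert_of_notMem hc, Finset.prod_insert hc, pow_succ',
      ← mul_assoc, h]
    linear_combination T (Function.update J c (I c)) * ih

/-- A unit tensor invariant under exchanging coordinates in pairs of arguments is a product of
unit vectors. -/
theorem exists_sphere_prod_eq [Fintype ι] [Nonempty ι] {N : ℕ} {T : (ι → Fin N) → ℂ}
    (hT : ∀ I J c, T I * T J = T (Function.update I c (J c)) * T (Function.update J c (I c)))
    (h1 : ∑ I, ‖T I‖ ^ 2 = 1) :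
    ∃ x : ι → ComplexSphere N, ∀ I, T I = ∏ c, (x c : EuclideanSpace ℂ (Fin N)) (I c) := by
  obtain ⟨J, hJ⟩ : ∃ J, T J ≠ 0 := by
    by_contra! h
    simp [h] at h1
  -- The candidate factors are the one-dimensional slices of `T` through a point `J` where `T` does
  -- not vanish; each contains the entry `T J`, so none is zero.
  let y : ι → EuclideanSpace ℂ (Fin N) := fun c =>
    WithLp.toLp 2 fun i => T (Function.update J c i)
  have hy : ∀ c, ‖y c‖ ≠ 0 := fun c h => by
    have h' : y c (J c) = 0 := by rw [norm_eq_zero.1 h]; rfl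
    exact hJ (by simpa [y] using h')
  let u : ι → EuclideanSpace ℂ (Fin N) := fun c => (‖y c‖ : ℂ)⁻¹ • y c
  have hu : ∀ c, ‖u c‖ = 1 := fun c => by simp [u, norm_smul, hy c]
  -- Solving the product formula over all coordinates for `T I` and normalizing the slices leaves
  -- this constant.
  let r : ℂ := T J * (T J ^ Fintype.card ι)⁻¹ * ∏ c, (‖y c‖ : ℂ)
  have hr : ∀ I, T I = r * ∏ c, u c (I c) := fun I => by
    have h := mul_pow_card_eq_prod_update hT J I Finset.univ
    rw [Finset.piecewise_univ, Finset.card_univ] at h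
    have hp : ∏ c, u c (I c) = (∏ c, (‖y c‖ : ℂ))⁻¹ * ∏ c, T (Function.update J c (I c)) := by
      simp [u, y, Finset.prod_mul_distrib]
    have hn : (∏ c, (‖y c‖ : ℂ)) ≠ 0 :=
      Finset.prod_ne_zero_iff.2 fun c _ => Complex.ofReal_ne_zero.2 (hy c)
    have hJ' : T J ^ Fintype.card ι ≠ 0 := pow_ne_zero _ hJ
    rw [hp]
    simp only [r]
    field_simp
    linear_combination h
  clear_value r
  have hr1 : ‖r‖ = 1 := by
    have hs : ∑ I : ι → Fin N, ∏ c, ‖u c (I c)‖ ^ 2 = 1 := by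
      rw [← Fintype.prod_sum fun c i => ‖u c i‖ ^ 2]
      refine Finset.prod_eq_one fun c _ => ?_
      rw [← EuclideanSpace.norm_sq_eq, hu, one_pow]
    have : ‖r‖ ^ 2 = 1 := by
      rw [← h1, ← mul_one (‖r‖ ^ 2), ← hs, Finset.mul_sum]
      refine Finset.sum_congr rfl fun I _ => ?_
      rw [hr I, norm_mul, norm_prod, mul_pow, Finset.prod_pow]
    nlinarith [norm_nonneg r]
  obtain ⟨c₀⟩ := ‹Nonempty ι›
  -- The leftover phase `r` is absorbed into a single factor, which requires an index to exist.
  refine ⟨fun c => ⟨(if c = c₀ then r else 1) • u c, ?_⟩, fun I => ?_⟩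
  · rw [mem_sphere_zero_iff_norm, norm_smul, hu]
    split_ifs <;> simp [hr1]
  · rw [hr I]
    have h : ∀ c, ((if c = c₀ then r else 1) • u c) (I c) = (if c = c₀ then r else 1) * u c (I c) :=
      fun c => rfl
    simp only [h, Finset.prod_mul_distrib]
    simp

end RankOne

/-! ## Characters of the block algebra -/

/-- The continuous characters of a commutative closed `*`-subalgebra separate its points. -/
theorem StarSubalgebra.eq_zero_of_forall_character {B : Type*} [CStarAlgebra B]
    {S : StarSubalgebra ℂ B} (hS : IsClosed (S : Set B)) (hcomm : ∀ a b : S, a * b = b * a) {a : S}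
    (ha : ∀ χ : S →⋆ₐ[ℂ] ℂ, Continuous χ → χ a = 0) : a = 0 := by
  let _ : CommCStarAlgebra S :=
    { (StarSubalgebra.cstarAlgebra S (h_closed := hS) : CStarAlgebra S) with mul_comm := hcomm }
  -- The Gelfand transform of a commutative `C*`-algebra is isometric, so vanishing at every
  -- character suffices.
  refine (gelfandTransform_isometry S).injective ?_
  rw [map_zero]
  ext χ
  exact ha (χ : S →⋆ₐ[ℂ] ℂ) (map_continuous χ)

theorem List.ofFn_update_eq {α : Type*} {n : ℕ} (f : Fin n → α) (c : Fin n) (a : α) :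
    List.ofFn (Function.update f c a) =
      (List.ofFn f).take c ++ a :: (List.ofFn f).drop (c + 1) := by
  have h : List.ofFn (Function.update f c a) = (List.ofFn f).set c a := by
    refine List.ext_getElem (by simp) fun k h₁ h₂ => ?_
    simp [List.getElem_set, Function.update_apply, Fin.ext_iff, eq_comm]
  rw [h, List.set_eq_take_append_cons_drop, if_pos (by simp)]

namespace IsHalfLiberated

/-- In the concatenation of `I` and `J` the two `c`-th letters are separated by `(K - 1 - c) + c = K
- 1` letters, the distance at which letters may be exchanged. -/
theorem word_mul_word_update {N K : ℕ} {B : Type*} [Ring B] [StarRing B] [Algebra ℂ B]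
    [StarModule ℂ B] [NeZero K] {z : Fin N → B} (hz : IsHalfLiberated K z) (I J : Fin K → Fin N)
    (c : Fin K) :
    word z (List.ofFn I) * word z (List.ofFn J) =
      word z (List.ofFn (Function.update I c (J c))) *
        word z (List.ofFn (Function.update J c (I c))) := by
  have hI := List.ofFn_update_eq I c (I c)
  have hJ := List.ofFn_update_eq J c (J c)
  rw [Function.update_eq_self] at hI hJ
  rw [List.ofFn_update_eq, List.ofFn_update_eq, ← hz.word_mul_word_swap, ← hI, ← hJ]
  simp
  omega

end IsHalfLiberated

namespace HLSphere

open CrossedProduct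

variable {N K : ℕ}

variable (N K) in
/-- The closed `*`-algebra generated by the words of length `K`. -/
abbrev blockCStar : StarSubalgebra ℂ (HLSphere N K) :=
  (blockAlgebra K (z : Fin N → HLSphere N K)).topologicalClosure

theorem word_mem_blockCStar {l : List (Fin N)} (hl : l.length = K) : word z l ∈ blockCStar N K :=
  StarSubalgebra.le_topologicalClosure _ (word_mem_blockAlgebra hl)

theorem commute_of_mem_blockCStar (a b : blockCStar N K) : a * b = b * a := by
  have := (isHalfLiberated_z N K).isMulCommutative_blockAlgebra
  let _ := StarSubalgebra.commRingTopologicalClosure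
    (blockAlgebra K (z : Fin N → HLSphere N K)) mul_comm'
  exact mul_comm a b

variable [NeZero K]

/-- Every character of the block algebra is given on words by a point of the sphere power. -/
theorem exists_point_of_character (χ : blockCStar N K →⋆ₐ[ℂ] ℂ) :
    ∃ x : SpherePower N K, ∀ (l : List (Fin N)) (hl : l.length = K),
      χ ⟨word z l, word_mem_blockCStar hl⟩ = wordFun 0 l x := by
  have hz := isHalfLiberated_z N K
  let W : (Fin K → Fin N) → blockCStar N K := fun I =>
    ⟨word z (List.ofFn I), word_mem_blockCStar List.length_ofFn⟩
  have hswap : ∀ I J c, W I * W J =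
      W (Function.update I c (J c)) * W (Function.update J c (I c)) := fun I J c =>
    Subtype.ext (hz.word_mul_word_update I J c)
  have hsum : ∑ I, W I * star (W I) = 1 := by
    refine Subtype.ext ?_
    rw [AddSubmonoidClass.coe_finsetSum]
    exact hz.sum_word_mul_star K
  obtain ⟨x, hx⟩ := exists_sphere_prod_eq (T := fun I => χ (W I))
    (fun I J c => by rw [← map_mul, hswap I J c, map_mul]) (by
      have h := congrArg χ hsum
      simp only [map_sum, map_mul, map_star, map_one, RCLike.star_def, Complex.mul_conj'] at h
      exact_mod_cast h)
  refine ⟨fun c => x ⟨c.val, ZMod.val_lt c⟩, fun l hl => ?_⟩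
  obtain ⟨I, rfl⟩ := List.exists_eq_ofFn_of_length_eq hl
  rw [wordFun_ofFn_apply]
  refine (hx I).trans (Finset.prod_congr rfl fun k _ => ?_)
  have hk : (⟨(0 + ((k : ℕ) : ZMod K)).val, ZMod.val_lt _⟩ : Fin K) = k :=
    Fin.ext ((congrArg ZMod.val (zero_add _)).trans (ZMod.val_natCast_of_lt k.2))
  rw [hk]

/-- On the block algebra the model is supported at `0`, so its coefficient there is multiplicative.
It agrees with `χ` on words of length `K` at the chosen point, hence on the generated `*`-algebra,
and by continuity on the closure. -/
theorem exists_character_eq_coeff_model {χ : blockCStar N K →⋆ₐ[ℂ] ℂ} (hχ : Continuous χ) :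
    ∃ x : SpherePower N K, ∀ a : blockCStar N K, χ a = (model N K a).coeff 0 x := by
  obtain ⟨x, hx⟩ := exists_point_of_character χ
  refine ⟨x, fun a => ?_⟩
  have key : ∀ (b : HLSphere N K) (hb : b ∈ blockAlgebra K z),
      χ ⟨b, StarSubalgebra.le_topologicalClosure _ hb⟩ = (model N K b).coeff 0 x := by
    intro b hb
    induction hb using StarAlgebra.adjoin_induction with
    | mem b hb =>
      obtain ⟨l, hl, rfl⟩ := hb
      rw [hx l hl, model_word, hl, ZMod.natCast_self, coeff_tmul, Pi.single_eq_same]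
    | algebraMap r =>
      rw [AlgHomClass.commutes, coeff_algebraMap]
      refine (AlgHomClass.commutes χ r).trans ?_
      simp
    | add b c hb hc ihb ihc =>
      rw [map_add]
      refine (map_add χ ⟨b, StarSubalgebra.le_topologicalClosure _ hb⟩
        ⟨c, StarSubalgebra.le_topologicalClosure _ hc⟩).trans ?_
      rw [ihb, ihc]
      rfl
    | mul b c hb hc ihb ihc =>
      rw [map_mul, coeff_mul_of_support (coeff_model_of_mem hb), ContinuousMap.mul_apply, ← ihb,
        ← ihc]
      exact map_mul χ ⟨b, StarSubalgebra.le_topologicalClosure _ hb⟩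
        ⟨c, StarSubalgebra.le_topologicalClosure _ hc⟩
    | star b hb ihb =>
      rw [map_star, coeff_star, act_zero, neg_zero, ContinuousMap.star_apply, ← ihb]
      exact map_star χ ⟨b, StarSubalgebra.le_topologicalClosure _ hb⟩
  have hc : Continuous fun a : blockCStar N K => (model N K a).coeff 0 x :=
    (continuous_eval_const (F := C(SpherePower N K, ℂ)) x).comp
      ((continuous_coeff 0).comp (continuous_model.comp continuous_subtype_val))
  have hd : Dense {a : blockCStar N K | (a : HLSphere N K) ∈ blockAlgebra K z} := by
    rw [Subtype.dense_iff]
    intro b hb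
    refine closure_mono ?_ hb
    exact fun c hc => ⟨⟨c, StarSubalgebra.le_topologicalClosure _ hc⟩, hc, rfl⟩
  exact (isClosed_eq hχ hc).closure_subset_iff.2 (fun b hb => key b hb) (hd a)

/-- Faithfulness of the expectation reduces the claim to `E (x* x) = 0`, which is tested on
characters: each is the coefficient at `0` at some point, and this coefficient is that of `π (x* x)
= 0`. -/
theorem injective_model : Function.Injective (model N K) := by
  refine (injective_iff_map_eq_zero _).2 fun x hx => eq_zero_of_expectation_star_mul_self ?_
  have hmem := expectation_mem (star x * x)
  suffices h : (⟨_, hmem⟩ : blockCStar N K) = 0 from congrArg Subtype.val h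
  refine StarSubalgebra.eq_zero_of_forall_character
    (StarSubalgebra.isClosed_topologicalClosure _) commute_of_mem_blockCStar fun χ hχ => ?_
  obtain ⟨y, hy⟩ := exists_character_eq_coeff_model hχ
  rw [hy]
  change (model N K (expectation N K (star x * x))).coeff 0 y = 0
  rw [coeff_model_expectation, map_mul, hx, mul_zero]
  rfl

end HLSphere

end

theorem theorem5p4 (N K : ℕ) [NeZero K] :
    ∃ π : HLSphere N K →⋆ₐ[ℂ] CrossedProduct (cyclicAction N K),
      (∀ i : Fin N, π (HLSphere.z i) = CrossedProduct.tmul (coordFun i 0) 1) ∧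
      Function.Injective π ∧
      Function.Injective ((CrossedProduct.toMatrix (cyclicAction N K)).comp π) :=
  ⟨HLSphere.model N K, HLSphere.model_z, HLSphere.injective_model,
    CrossedProduct.toMatrixFun_injective.comp HLSphere.injective_model⟩
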